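/- **Notation.** Let $d\ge 2$ and $n,D\in\mathbb N$. For a vector $x$: $\|x\|_\infty=\max_i|x_i|$, $\|x\|_{-\infty}=\min_i|x_i|$, $\mu(x)=\frac1d\sum_i x_i$, $\operatorname{centr}(x)=x-\mu(x)e$ with $e=(1,\dots,1)^\top$. A vector or matrix is *generic* if all its entries are non-zero; $|\cdot|$ of vectors and matrices is entrywise; $x_t$ is the $t$-th column of $X$ and $X_t$ the submatrix of its first $t$ columns; $f^*$ applies $f$ to each column. Ratios take values in $[0,\infty]$ with $a/0=\infty$ for $a>0$ and $0/0=0$. The componentwise relative distance is $\rho_c(\hat X,X)=\max_{i,t}|\hat x_{i,t}-x_{i,t}|/|x_{i,t}|$. **Layers.** A configuration $\Theta=(D,A_1,b_1,A_2,b_2,W_q,W_k,W_v)$ consists of $A_1\in\mathbb R^{D\times d}$, $b_1\in\mathbb R^D$, $A_2\in\mathbb R^{d\times D}$, $b_2\in\mathbb R^d$, $W_q,W_k,W_v\in\mathbb R^{d\times d}$. Put $$N(x)=\frac{x-\mu(x)e}{\sqrt{\frac1d\sum_i(x_i-\mu(x))^2}},\quad R(x)=\sqrt d\,\frac{x}{\|x\|_2},\quad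 L_1(x)=A_1x+b_1,\quad M(x)=A_2\max\{0,L_1(x)\}+b_2,$$ $$S(X)=\tfrac1{\sqrt d}(W_kX)^\top(W_qx_t)\in\mathbb R^t\ \ (X\in\mathbb R^{d\times t}),\qquad \psi(s)_i=\frac{e^{s_i}}{\sum_je^{s_j}},$$ and let $A(X)\in\mathbb R^{d\times n}$ have the columns $W_vX_t\psi(S(X_t))$, $1\le t\le n$. For $\nu\in\{R,N\}$ let $F^\nu_A(X)=X+A(\nu^*(X))$ and $F^\nu_M(x)=x+M(\nu(x))$. The transformer blocks are $Q_\Theta=(F^R_M)^*\circ F^R_A$ and $T_\Theta=(F^N_M)^*\circ F^N_A$. **Arithmetic.** The blocks are evaluated with unit roundoff $u>0$ in the standard model: each elementary operation ($+,-,\times,/,\exp,\sqrt{\cdot}$) with exact result $z$ returns $z(1+\delta)$ for some $|\delta|\le u$ (possibly different each time). Sums are computed recursively, $A x$ row by row, $Ax+b$ as the computed $Ax$ plus $b$, $R(x)_i$ as $(\sqrt d\cdot x_i)/\|x\|_2$, $\operatorname{centr}(x)$ as $x_i$ minus the computed mean, $N(x)$ as $R$ of the computed $\operatorname{centr}(x)$,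 $S(X)_i$ as the inner product of the computed $W_kx_i$ and $W_qx_t$ divided by $\sqrt d$, $\psi$ by the formula above, and $W_vX_t\psi$ as $W_v(X_t\psi)$. The ReLU is exact, and the constant $\sqrt d$ is exact or itself rounded once. $\mathrm{fl}(f(\hat X))$ is any output so obtained from the (exactly given) matrix $\hat X$ and parameters $\Theta$. Let $\gamma_d=du/(1-du)$. **Quantities in the bounds.** $$\xi(A,X)=\max_{i,t}\frac{(|W_v||X_t|\psi(S(X_t)))_i}{|A(X)_{i,t}|},\qquad \xi(F^\nu_A,X)=\max_{i,t}\frac{|x_{i,t}|+|A(\nu^*(X))_{i,t}|}{|F^\nu_A(X)_{i,t}|},$$ $$\xi(M,x)=\max_i\frac{\sum_{k:\,L_1(x)_k>0}|A_2|_{i,k}\,(|A_1||x|+|b_1|)_k+|b_2|_i}{|M(x)_i|},\qquad \xi(F^\nu_M,x)=\max_i\frac{|x_i|+|M(\nu(x))_i|}{|F^\nu_M(x)_i|},$$ $$K=1+4\sqrt d\,\sigma_{\max}(|W_k|^\top|W_q|)\,\frac{\sigma_{\max}(W_k^\top W_q)}{\sigma_{\min}(W_k^\top W_q)},$$ where $\sigma_{\max},\sigma_{\min}$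 are the largest and smallest singular values. **Statement.** Let $W_k^\top W_q$ be non-singular and $X\in\mathbb R^{d\times n}$. In each part below, "$\mathcal O$", "$u$ sufficiently small" and "$\rho_c(\hat X,X)$ sufficiently small" mean: there are $C\ge0$, $u_0>0$, $r_0>0$ depending only on $d,n,\Theta,X$ such that the bound, with the $\mathcal O$-term replaced by $C(u^2+\rho_c(\hat X,X)^2)$, holds for all $0<u\le u_0$ and all $\alpha\ge1$ for which the assumptions hold, all $\hat X$ with $\rho_c(\hat X,X)\le r_0$, and all computed outputs. **1.** Let $Y=F^R_A(X)$. Assume that the columns $x_t$ and $y_t$ are non-zero, that $A(R^*(X))$ and all $M(R(y_t))$ are generic, and that, for an $\alpha\ge1$ and all $t$, entrywise $$|L_1(R(y_t))|>\alpha\,(u+(1+u)\gamma_d)\,(|A_1||R(y_t)|+|b_1|).$$ If $u$ and $\rho_c(\hat X,X)$ are sufficiently small, then $$\rho_c\big(\mathrm{fl}(Q_\Theta(\hat X)),Q_\Theta(X)\big)\le\max_t\{\xi(F^R_M,y_t)\,\xi(M,R(y_t))\}\,\xi(F^R_A,X)\,\xi(A,R^*(X))\,K\,\big((6n+23d+D)u+9\rho_c(\hat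 X,X)\big)+\mathcal O\big(u^2+\rho_c(\hat X,X)^2\big).$$ **2.** Let $Y=F^N_A(X)$. Assume that $A(N^*(X))$ and all $M(N(y_t))$ are generic and that, for an $\alpha\ge1$ and all $t$, $$\|\operatorname{centr}(x_t)\|_{-\infty}>2\alpha(1+u)\gamma_d\|x_t\|_\infty,\qquad \|\operatorname{centr}(y_t)\|_{-\infty}>2\alpha(1+u)\gamma_d\|y_t\|_\infty,$$ and, entrywise, $|L_1(N(y_t))|>\alpha(u+(1+u)\gamma_d)(|A_1||N(y_t)|+|b_1|)$. If $u$ and $\rho_c(\hat X,X)$ are sufficiently small, then $$\rho_c\big(\mathrm{fl}(T_\Theta(\hat X)),T_\Theta(X)\big)\le\max_t\{\xi(F^N_M,y_t)\,\xi(M,N(y_t))\}\,\xi(F^N_A,X)\,\xi(A,N^*(X))\,K\Big(1+\max_t\tfrac{\|x_t\|_\infty}{\|\operatorname{centr}(x_t)\|_{-\infty}}\Big)\Big(1+\max_t\tfrac{\|y_t\|_\infty}{\|\operatorname{centr}(y_t)\|_{-\infty}}\Big)\big((8n+34d+D)u+16\rho_c(\hat X,X)\big)+\mathcal O\big(u^2+\rho_c(\hat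 X,X)^2\big).$$ -/

import Mathlib

open scoped ENNReal Matrix

noncomputable section

namespace TransformerRounding

/-! ### Exact layers -/

/-- A matrix is generic if all of its entries are non-zero. -/
def Generic {d n : ℕ} (X : Matrix (Fin d) (Fin n) ℝ) : Prop := ∀ i t, X i t ≠ 0

/-- A vector is generic if all of its entries are non-zero. -/
def GenericVec {d : ℕ} (x : Fin d → ℝ) : Prop := ∀ i, x i ≠ 0

/-- The functional `‖x‖_{-∞} = min_i |x i|`. -/
def minAbs {d : ℕ} (x : Fin d → ℝ) : ℝ := ⨅ i, |x i|

/-- Entrywise absolute value of a matrix. -/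
def absMat {m n : ℕ} (A : Matrix (Fin m) (Fin n) ℝ) : Matrix (Fin m) (Fin n) ℝ :=
  A.map fun a => |a|

/-- Entrywise absolute value of a vector. -/
def absVec {m : ℕ} (x : Fin m → ℝ) : Fin m → ℝ := fun i => |x i|

/-- Columnwise application of a function to a matrix. -/
def colMap {d D n : ℕ} (f : (Fin d → ℝ) → (Fin D → ℝ)) (X : Matrix (Fin d) (Fin n) ℝ) :
    Matrix (Fin D) (Fin n) ℝ :=
  Matrix.of fun i t => f (X.col t) i

/-- Sample mean. -/
def mean {d : ℕ} (x : Fin d → ℝ) : ℝ := (1 / (d : ℝ)) * ∑ i, x i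

/-- Sample variance (biased). -/
def var {d : ℕ} (x : Fin d → ℝ) : ℝ := (1 / (d : ℝ)) * ∑ i, (x i - mean x) ^ 2

/-- Centring `x - μ(x) e`. -/
def centr {d : ℕ} (x : Fin d → ℝ) : Fin d → ℝ := fun i => x i - mean x

/-- Layer normalization `N`. -/
def layerNorm {d : ℕ} (x : Fin d → ℝ) : Fin d → ℝ := fun i => (x i - mean x) / √(var x)

/-- RMS layer normalization `R(x) = √d x / ‖x‖₂`. -/
def rmsNorm {d : ℕ} (x : Fin d → ℝ) : Fin d → ℝ :=
  fun i => √(d : ℝ) * (x i / ‖WithLp.toLp 2 x‖)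

/-- A transformer configuration `(D, A₁, b₁, A₂, b₂, W_q, W_k, W_v)`. -/
structure Config (d : ℕ) where
  D : ℕ
  A₁ : Matrix (Fin D) (Fin d) ℝ
  b₁ : Fin D → ℝ
  A₂ : Matrix (Fin d) (Fin D) ℝ
  b₂ : Fin d → ℝ
  Wq : Matrix (Fin d) (Fin d) ℝ
  Wk : Matrix (Fin d) (Fin d) ℝ
  Wv : Matrix (Fin d) (Fin d) ℝ

/-- Entrywise ReLU. -/
def relu {m : ℕ} (y : Fin m → ℝ) : Fin m → ℝ := fun k => max 0 (y k)

/-- First affine layer `A₁ x + b₁` of the perceptron. -/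
def layer₁ {d : ℕ} (Θ : Config d) (x : Fin d → ℝ) : Fin Θ.D → ℝ := Θ.A₁ *ᵥ x + Θ.b₁

/-- Second affine layer `A₂ y + b₂` of the perceptron. -/
def layer₂ {d : ℕ} (Θ : Config d) (y : Fin Θ.D → ℝ) : Fin d → ℝ := Θ.A₂ *ᵥ y + Θ.b₂

/-- Two-layer perceptron `M`. -/
def tlp {d : ℕ} (Θ : Config d) (x : Fin d → ℝ) : Fin d → ℝ := layer₂ Θ (relu (layer₁ Θ x))

/-- The sub-matrix of the columns `0, …, t` of `X`. -/
def firstCols {d n : ℕ} (X : Matrix (Fin d) (Fin n) ℝ) (t : Fin n) :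
    Matrix (Fin d) (Fin (t + 1)) ℝ :=
  X.submatrix id (Fin.castLE t.isLt)

/-- Similarity scores `S(X) = (1/√d) (W_k X)ᵀ (W_q x_last)`. -/
def scores {d m : ℕ} (Θ : Config d) (X : Matrix (Fin d) (Fin (m + 1)) ℝ) : Fin (m + 1) → ℝ :=
  (1 / √(d : ℝ)) • ((Θ.Wk * X)ᵀ *ᵥ (Θ.Wq *ᵥ X.col (Fin.last m)))

/-- Softmax `ψ`. -/
def softmax {m : ℕ} (s : Fin m → ℝ) : Fin m → ℝ :=
  fun i => Real.exp (s i) / ∑ j, Real.exp (s j)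

/-- The vector of probabilities `ψ(S(X_t))`. -/
def probs {d n : ℕ} (Θ : Config d) (X : Matrix (Fin d) (Fin n) ℝ) (t : Fin n) :
    Fin (t + 1) → ℝ :=
  softmax (scores Θ (firstCols X t))

/-- Causal self-attention `A`; its column `t` is `W_v X_t ψ(S(X_t))`. -/
def attention {d n : ℕ} (Θ : Config d) (X : Matrix (Fin d) (Fin n) ℝ) :
    Matrix (Fin d) (Fin n) ℝ :=
  Matrix.of fun i t => (Θ.Wv *ᵥ (firstCols X t *ᵥ probs Θ X t)) i

/-- Self-attention sub-block `X ↦ X + A(ν* X)` with the normalization `ν`. -/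
def attnBlock {d n : ℕ} (ν : (Fin d → ℝ) → (Fin d → ℝ)) (Θ : Config d)
    (X : Matrix (Fin d) (Fin n) ℝ) : Matrix (Fin d) (Fin n) ℝ :=
  X + attention Θ (colMap ν X)

/-- Perceptron sub-block `x ↦ x + M(ν x)` with the normalization `ν`. -/
def tlpBlock {d : ℕ} (ν : (Fin d → ℝ) → (Fin d → ℝ)) (Θ : Config d)
    (x : Fin d → ℝ) : Fin d → ℝ :=
  x + tlp Θ (ν x)

/-- The RMS transformer block `Q_Θ = (Id + M* ∘ R*) ∘ (Id + A ∘ R*)`. -/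
def blockQ {d n : ℕ} (Θ : Config d) (X : Matrix (Fin d) (Fin n) ℝ) :
    Matrix (Fin d) (Fin n) ℝ :=
  colMap (tlpBlock rmsNorm Θ) (attnBlock rmsNorm Θ X)

/-- The transformer block `T_Θ = (Id + M* ∘ N*) ∘ (Id + A ∘ N*)`. -/
def blockT {d n : ℕ} (Θ : Config d) (X : Matrix (Fin d) (Fin n) ℝ) :
    Matrix (Fin d) (Fin n) ℝ :=
  colMap (tlpBlock layerNorm Θ) (attnBlock layerNorm Θ X)

/-! ### Floating-point evaluation

`Fl u x z` says that `z` is an admissible result of one elementary operation (`+`, `-`, `×`, `/`,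
`exp`, `√`) whose exact result is `x`, in an arithmetic with unit roundoff `u`. The relations
below it describe all outputs that an algorithm can produce when every one of its elementary
operations is rounded in this way; no determinism of the rounding is required, so the outputs of
every concrete arithmetic that obeys the standard model are among them. -/

/-- The standard model: `z = x (1 + δ)` with `|δ| ≤ u`. -/
def Fl (u x z : ℝ) : Prop := ∃ δ : ℝ, |δ| ≤ u ∧ z = x * (1 + δ)

/-- Recursive summation `((a₀ + a₁) + a₂) + ⋯`. -/
def FlSum (u : ℝ) : (m : ℕ) → (Fin m → ℝ) → ℝ → Prop
  | 0, _, z => z = 0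
  | 1, a, z => z = a 0
  | m + 2, a, z =>
      ∃ w, FlSum u (m + 1) (fun i => a i.castSucc) w ∧ Fl u (w + a (Fin.last (m + 1))) z

/-- Inner product: products, then recursive summation. -/
def FlDot (u : ℝ) {m : ℕ} (a b : Fin m → ℝ) (z : ℝ) : Prop :=
  ∃ p : Fin m → ℝ, (∀ i, Fl u (a i * b i) (p i)) ∧ FlSum u m p z

/-- Matrix-vector product, row by row. -/
def FlMulVec (u : ℝ) {m n : ℕ} (A : Matrix (Fin m) (Fin n) ℝ) (x : Fin n → ℝ)
    (z : Fin m → ℝ) : Prop :=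
  ∀ i, FlDot u (A i) x (z i)

/-- `A x + b`: the product `A x`, then the addition of `b`. -/
def FlAffine (u : ℝ) {m n : ℕ} (A : Matrix (Fin m) (Fin n) ℝ) (b : Fin m → ℝ)
    (x : Fin n → ℝ) (z : Fin m → ℝ) : Prop :=
  ∃ w, FlMulVec u A x w ∧ ∀ i, Fl u (w i + b i) (z i)

/-- RMS layer normalization: the norm `s` of `x`, then `(c * x i) / s`. The constant `c` is `√d`,
either exact or itself rounded. -/
def FlRms (u : ℝ) {d : ℕ} (x z : Fin d → ℝ) : Prop :=
  ∃ c q s : ℝ, Fl u √(d : ℝ) c ∧ FlDot u x x q ∧ Fl u √q s ∧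
    ∀ i, ∃ w, Fl u (c * x i) w ∧ Fl u (w / s) (z i)

/-- Centring: the sum, the division by `d`, the subtraction of the mean. -/
def FlCentr (u : ℝ) {d : ℕ} (x z : Fin d → ℝ) : Prop :=
  ∃ s μ : ℝ, FlSum u d x s ∧ Fl u (s / (d : ℝ)) μ ∧ ∀ i, Fl u (x i - μ) (z i)

/-- Layer normalization: centring, then RMS layer normalization. -/
def FlLayerNorm (u : ℝ) {d : ℕ} (x z : Fin d → ℝ) : Prop :=
  ∃ y, FlCentr u x y ∧ FlRms u y z

/-- Two-layer perceptron; the ReLU is exact. -/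
def FlTlp (u : ℝ) {d : ℕ} (Θ : Config d) (x z : Fin d → ℝ) : Prop :=
  ∃ y, FlAffine u Θ.A₁ Θ.b₁ x y ∧ FlAffine u Θ.A₂ Θ.b₂ (relu y) z

/-- Similarity scores: the query, the keys, their inner products, the division by `√d` (which is
exact or itself rounded). -/
def FlScores (u : ℝ) {d m : ℕ} (Θ : Config d) (X : Matrix (Fin d) (Fin (m + 1)) ℝ)
    (s : Fin (m + 1) → ℝ) : Prop :=
  ∃ (c : ℝ) (q : Fin d → ℝ), Fl u √(d : ℝ) c ∧ FlMulVec u Θ.Wq (X.col (Fin.last m)) q ∧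
    ∀ i, ∃ (k : Fin d → ℝ) (w : ℝ),
      FlMulVec u Θ.Wk (X.col i) k ∧ FlDot u k q w ∧ Fl u (w / c) (s i)

/-- Softmax: the exponentials, their recursive summation, the divisions. -/
def FlSoftmax (u : ℝ) {m : ℕ} (s z : Fin m → ℝ) : Prop :=
  ∃ (e : Fin m → ℝ) (S : ℝ), (∀ i, Fl u (Real.exp (s i)) (e i)) ∧ FlSum u m e S ∧
    ∀ i, Fl u (e i / S) (z i)

/-- Self-attention, column by column: scores, softmax, the product with `X_t`, the product with
`W_v`. -/
def FlAttention (u : ℝ) {d n : ℕ} (Θ : Config d) (X Z : Matrix (Fin d) (Fin n) ℝ) : Prop :=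
  ∀ t : Fin n, ∃ (s p : Fin (t + 1) → ℝ) (v : Fin d → ℝ),
    FlScores u Θ (firstCols X t) s ∧ FlSoftmax u s p ∧ FlMulVec u (firstCols X t) p v ∧
      FlMulVec u Θ.Wv v (Z.col t)

/-- Self-attention sub-block, with computed normalization `flν`. -/
def FlAttnBlock {d n : ℕ} (flν : (Fin d → ℝ) → (Fin d → ℝ) → Prop) (u : ℝ)
    (Θ : Config d) (X Z : Matrix (Fin d) (Fin n) ℝ) : Prop :=
  ∃ R A : Matrix (Fin d) (Fin n) ℝ, (∀ t, flν (X.col t) (R.col t)) ∧ FlAttention u Θ R A ∧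
    ∀ i t, Fl u (X i t + A i t) (Z i t)

/-- Perceptron sub-block, with computed normalization `flν`. -/
def FlTlpBlock {d : ℕ} (flν : (Fin d → ℝ) → (Fin d → ℝ) → Prop) (u : ℝ)
    (Θ : Config d) (x z : Fin d → ℝ) : Prop :=
  ∃ r m : Fin d → ℝ, flν x r ∧ FlTlp u Θ r m ∧ ∀ i, Fl u (x i + m i) (z i)

/-- `Z` is a computed value of `Q_Θ(X)`. -/
def FlBlockQ (u : ℝ) {d n : ℕ} (Θ : Config d) (X Z : Matrix (Fin d) (Fin n) ℝ) : Prop :=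
  ∃ Y : Matrix (Fin d) (Fin n) ℝ, FlAttnBlock (FlRms u) u Θ X Y ∧
    ∀ t, FlTlpBlock (FlRms u) u Θ (Y.col t) (Z.col t)

/-- `Z` is a computed value of `T_Θ(X)`. -/
def FlBlockT (u : ℝ) {d n : ℕ} (Θ : Config d) (X Z : Matrix (Fin d) (Fin n) ℝ) : Prop :=
  ∃ Y : Matrix (Fin d) (Fin n) ℝ, FlAttnBlock (FlLayerNorm u) u Θ X Y ∧
    ∀ t, FlTlpBlock (FlLayerNorm u) u Θ (Y.col t) (Z.col t)

/-! ### Relative distances and the quantities in the bounds -/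

/-- `|a| / |b|` in `[0, ∞]`, with `a / 0 = ∞` for `a ≠ 0` and `0 / 0 = 0`. -/
def ratio (a b : ℝ) : ℝ≥0∞ := ENNReal.ofReal |a| / ENNReal.ofReal |b|

/-- Componentwise relative distance `ρ_c(X̂, X)`. -/
def rhoC {d n : ℕ} (Xh X : Matrix (Fin d) (Fin n) ℝ) : ℝ≥0∞ :=
  ⨆ (i : Fin d) (t : Fin n), ratio (Xh i t - X i t) (X i t)

/-- `γ_k = k u / (1 - k u)`. -/
def gam (u : ℝ) (k : ℕ) : ℝ := k * u / (1 - k * u)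

/-- `ξ(A, X)`. -/
def xiAttn {d n : ℕ} (Θ : Config d) (X : Matrix (Fin d) (Fin n) ℝ) : ℝ≥0∞ :=
  ⨆ (i : Fin d) (t : Fin n),
    ratio ((absMat Θ.Wv *ᵥ (absMat (firstCols X t) *ᵥ probs Θ X t)) i) (attention Θ X i t)

/-- `ξ(f_A, X)` (for `ν = R`) and `ξ(g_A, X)` (for `ν = N`). -/
def xiAttnBlock {d n : ℕ} (ν : (Fin d → ℝ) → (Fin d → ℝ)) (Θ : Config d)
    (X : Matrix (Fin d) (Fin n) ℝ) : ℝ≥0∞ :=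
  ⨆ (i : Fin d) (t : Fin n),
    ratio (|X i t| + |attention Θ (colMap ν X) i t|) (attnBlock ν Θ X i t)

/-- `ξ(M, x)`; the sum is over the positive support of `A₁ x + b₁`. -/
def xiTlp {d : ℕ} (Θ : Config d) (x : Fin d → ℝ) : ℝ≥0∞ :=
  ⨆ i : Fin d,
    ratio ((∑ k with 0 < layer₁ Θ x k,
      |Θ.A₂ i k| * ((absMat Θ.A₁ *ᵥ absVec x) k + |Θ.b₁ k|)) + |Θ.b₂ i|) (tlp Θ x i)

/-- `ξ(f_M, x)` (for `ν = R`) and `ξ(g_M, x)` (for `ν = N`). -/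
def xiTlpBlock {d : ℕ} (ν : (Fin d → ℝ) → (Fin d → ℝ)) (Θ : Config d)
    (x : Fin d → ℝ) : ℝ≥0∞ :=
  ⨆ i : Fin d, ratio (|x i| + |tlp Θ (ν x) i|) (tlpBlock ν Θ x i)

/-- Largest singular value. -/
def sigmaMax {d : ℕ} (A : Matrix (Fin d) (Fin d) ℝ) : ℝ :=
  (Matrix.toEuclideanLin A).singularValues 0

/-- Smallest singular value, for `d ≥ 1`. -/
def sigmaMin {d : ℕ} (A : Matrix (Fin d) (Fin d) ℝ) : ℝ :=
  (Matrix.toEuclideanLin A).singularValues (d - 1)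

/-- `1 + 4 √d σ_max(|W_k|ᵀ |W_q|) σ_max(W_kᵀ W_q) / σ_min(W_kᵀ W_q)`. -/
def attnFactor {d : ℕ} (Θ : Config d) : ℝ :=
  1 + 4 * √(d : ℝ) * sigmaMax ((absMat Θ.Wk)ᵀ * absMat Θ.Wq) *
    (sigmaMax (Θ.Wkᵀ * Θ.Wq) / sigmaMin (Θ.Wkᵀ * Θ.Wq))

/-- `1 + max_t ‖x_t‖_∞ / ‖centr x_t‖_{-∞}`. -/
def normFactor {d n : ℕ} (X : Matrix (Fin d) (Fin n) ℝ) : ℝ≥0∞ :=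
  1 + ⨆ t : Fin n, ratio ‖X.col t‖ (minAbs (centr (X.col t)))

/-! ### Assumptions -/

/-- `|A₁ x + b₁| > α (u + (1 + u) γ_d) (|A₁| |x| + |b₁|)` entrywise. -/
def SignStable {d : ℕ} (Θ : Config d) (α u : ℝ) (x : Fin d → ℝ) : Prop :=
  ∀ k, α * (u + (1 + u) * gam u d) * ((absMat Θ.A₁ *ᵥ absVec x) k + |Θ.b₁ k|) <
    |layer₁ Θ x k|

/-- `‖centr x‖_{-∞} > 2 α (1 + u) γ_d ‖x‖_∞`. -/
def CentrStable {d : ℕ} (α u : ℝ) (x : Fin d → ℝ) : Prop :=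
  α * 2 * (1 + u) * gam u d * ‖x‖ < minAbs (centr x)

/-- Assumptions for the self-attention sub-block with `R`; the columns are non-zero because `R` is
defined only there. -/
def AssumeAttnR {d n : ℕ} (Θ : Config d) (X : Matrix (Fin d) (Fin n) ℝ) : Prop :=
  (∀ t, X.col t ≠ 0) ∧ Generic (attention Θ (colMap rmsNorm X))

/-- Assumptions for the perceptron sub-block with `R`. -/
def AssumeTlpR {d : ℕ} (Θ : Config d) (α u : ℝ) (y : Fin d → ℝ) : Prop :=
  y ≠ 0 ∧ GenericVec (tlp Θ (rmsNorm y)) ∧ SignStable Θ α u (rmsNorm y)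

/-- Assumptions for the self-attention sub-block with `N`. -/
def AssumeAttnN {d n : ℕ} (Θ : Config d) (α u : ℝ) (X : Matrix (Fin d) (Fin n) ℝ) : Prop :=
  (∀ t, CentrStable α u (X.col t)) ∧ Generic (attention Θ (colMap layerNorm X))

/-- Assumptions for the perceptron sub-block with `N`. -/
def AssumeTlpN {d : ℕ} (Θ : Config d) (α u : ℝ) (y : Fin d → ℝ) : Prop :=
  CentrStable α u y ∧ GenericVec (tlp Θ (layerNorm y)) ∧ SignStable Θ α u (layerNorm y)

end TransformerRounding

end

open TransformerRounding

noncomputable section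

namespace TransformerRounding

/-! ### Singular values -/

/-! Errors are measured on an exponential scale. `Rel a` means a factor `e^θ` with `|θ| ≤ a`; `Cl a
B` means an absolute error of at most `(e^a - 1) B`, where `B` dominates the exact value. In both
calculi, exponents simply add under products and under further roundings, so no second-order cross
terms appear. `Cl` handles sums with cancellation, and `Rel` handles products, quotients, square
roots and sums of non-negative terms.

The condition numbers pass from `Cl` back to relative errors. If `B ≤ ξ |z|`, then `Cl.scale`
replaces `B` by `|z|` and `a` by `ξ a`, and `Cl.toRel` turns the result into a `Rel` statement at
the price of a factor `κ` slightly above one.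

In attention, normalized columns have Euclidean norm at most `√d`, so the absolute error of the
scores is at most about `√d σ_max(|W_k|ᵀ|W_q|)` times their exponent. Softmax turns an absolute
error `Δ` of the scores into a relative error `2Δ`, which yields the factor `1 + 4 √d
σ_max(|W_k|ᵀ|W_q|)`. The quotient `σ_max / σ_min` in `attnFactor` is at least one and can only
enlarge this. In the perceptron, non-zero entries of the first layer keep their signs under small
perturbations, so the ReLU has the same positive support for exact and computed data. Centring costs
the factor `1 + ‖x‖_∞ / ‖centr x‖_{-∞}`.

`BlockData.abs_sub_le` composes these estimates with `κ` as a free parameter and obtains `κ^6 T`,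
with `T` linear in `u` and in the input error. `BlockData.exists_abs_sub_le` takes `κ - 1`
proportional to `u + ε`, so the excess over `T` is quadratic. `exists_rhoC_le` moves the bound to
`[0, ∞]` for both normalizations at once. -/

theorem norm_apply_le_singularValues_zero {E F : Type*} [NormedAddCommGroup E]
    [InnerProductSpace ℝ E] [FiniteDimensional ℝ E] [NormedAddCommGroup F]
    [InnerProductSpace ℝ F] [FiniteDimensional ℝ F] (T : E →ₗ[ℝ] F) (x : E) :
    ‖T x‖ ≤ T.singularValues 0 * ‖x‖ := by
  have h0 := T.singularValues_nonneg 0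
  refine le_of_sq_le_sq ?_ (mul_nonneg h0 (norm_nonneg x))
  set hs := T.isSymmetric_adjoint_comp_self
  set b := hs.eigenvectorBasis rfl
  -- In an orthonormal eigenbasis of `T* T` the square of the norm is a weighted sum of squares, and
  -- the weights are the squared singular values.
  have key : ‖T x‖ ^ 2 = ∑ i, hs.eigenvalues rfl i * (inner ℝ (b i) x) ^ 2 := by
    rw [← real_inner_self_eq_norm_sq, ← LinearMap.adjoint_inner_right,
      ← b.sum_inner_mul_inner x]
    refine Finset.sum_congr rfl fun i _ => ?_
    have h1 : inner ℝ (b i) ((LinearMap.adjoint T) (T x)) =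
        hs.eigenvalues rfl i * inner ℝ (b i) x := by
      have h2 := hs (b i) x
      simp only [LinearMap.comp_apply] at h2
      rw [← h2]
      have h3 := hs.apply_eigenvectorBasis rfl i
      simp only [LinearMap.comp_apply] at h3
      simp only [b]
      rw [h3]
      simp [real_inner_smul_left]
    rw [h1, real_inner_comm]
    ring
  rw [key, mul_pow, ← b.sum_sq_norm_inner_right x, Finset.mul_sum]
  refine Finset.sum_le_sum fun i _ => ?_
  rw [Real.norm_eq_abs, sq_abs]
  refine mul_le_mul_of_nonneg_right ?_ (sq_nonneg _)
  rw [← T.sq_singularValues_fin rfl i]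
  have := T.singularValues_antitone (Nat.zero_le (i : ℕ))
  exact pow_le_pow_left₀ (T.singularValues_nonneg _) this 2

theorem dotProduct_mulVec_le_sigmaMax {d : ℕ} (A : Matrix (Fin d) (Fin d) ℝ) (x y : Fin d → ℝ) :
    x ⬝ᵥ (A *ᵥ y) ≤ sigmaMax A * (‖WithLp.toLp 2 x‖ * ‖WithLp.toLp 2 y‖) := by
  have h1 := norm_apply_le_singularValues_zero (Matrix.toEuclideanLin A) (WithLp.toLp 2 y)
  have h2 := real_inner_le_norm (WithLp.toLp 2 x) (Matrix.toEuclideanLin A (WithLp.toLp 2 y))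
  have h3 : inner ℝ (WithLp.toLp 2 x) (Matrix.toEuclideanLin A (WithLp.toLp 2 y)) =
      x ⬝ᵥ (A *ᵥ y) := by
    simp [PiLp.inner_apply, dotProduct, mul_comm]
  rw [h3] at h2
  calc _ ≤ _ := h2
    _ ≤ ‖WithLp.toLp 2 x‖ * (sigmaMax A * ‖WithLp.toLp 2 y‖) :=
        mul_le_mul_of_nonneg_left h1 (norm_nonneg _)
    _ = _ := by ring

theorem sigmaMax_nonneg {d : ℕ} (A : Matrix (Fin d) (Fin d) ℝ) : 0 ≤ sigmaMax A :=
  LinearMap.singularValues_nonneg _ _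

theorem one_le_sigmaMax_div_sigmaMin {d : ℕ} (hd : 0 < d) (A : Matrix (Fin d) (Fin d) ℝ)
    (hA : IsUnit A) : 1 ≤ sigmaMax A / sigmaMin A := by
  have hinj : Function.Injective (Matrix.toEuclideanLin A) := by
    intro x y hxy
    have : A *ᵥ x.ofLp = A *ᵥ y.ofLp := by
      have := congrArg WithLp.ofLp hxy
      simpa using this
    exact WithLp.ofLp_injective 2 (Matrix.mulVec_injective_of_isUnit hA this)
  have hpos : 0 < sigmaMin A :=
    (LinearMap.injective_iff_forall_lt_finrank_singularValues_pos _).1 hinj (d - 1)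
      (by simpa using hd)
  rw [one_le_div hpos]
  exact LinearMap.singularValues_antitone _ (Nat.zero_le _)

/-- The error analysis produces the left-hand side; non-singularity makes `σ_max / σ_min` a genuine
quotient that is at least one. -/
theorem one_add_le_attnFactor {d : ℕ} (hd : 0 < d) (Θ : Config d) (hW : IsUnit (Θ.Wkᵀ * Θ.Wq)) :
    1 + 4 * √(d : ℝ) * sigmaMax ((absMat Θ.Wk)ᵀ * absMat Θ.Wq) ≤ attnFactor Θ := by
  have h := one_le_sigmaMax_div_sigmaMin hd _ hW
  have h0 := sigmaMax_nonneg ((absMat Θ.Wk)ᵀ * absMat Θ.Wq)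
  unfold attnFactor
  have : 0 ≤ 4 * √(d : ℝ) * sigmaMax ((absMat Θ.Wk)ᵀ * absMat Θ.Wq) := by positivity
  nlinarith

theorem one_le_attnFactor {d : ℕ} (hd : 0 < d) (Θ : Config d) (hW : IsUnit (Θ.Wkᵀ * Θ.Wq)) :
    1 ≤ attnFactor Θ := by
  have := one_add_le_attnFactor hd Θ hW
  have h0 := sigmaMax_nonneg ((absMat Θ.Wk)ᵀ * absMat Θ.Wq)
  have : 0 ≤ 4 * √(d : ℝ) * sigmaMax ((absMat Θ.Wk)ᵀ * absMat Θ.Wq) := by positivity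
  linarith

/-! ### Perturbation calculus -/

/-- `zh` is `z` up to a factor in `[e⁻ᵃ, eᵃ]`. -/
def Rel (a z zh : ℝ) : Prop := ∃ θ : ℝ, |θ| ≤ a ∧ zh = z * Real.exp θ

/-- `zh` approximates `z` with error `(eᵃ - 1) B`, where `B` bounds `z`. -/
def Cl (a B z zh : ℝ) : Prop := |z| ≤ B ∧ |zh - z| ≤ (Real.exp a - 1) * B

theorem exp_sub_one_nonneg {a : ℝ} (ha : 0 ≤ a) : 0 ≤ Real.exp a - 1 := by
  linarith [Real.one_le_exp ha]

theorem abs_exp_sub_one_le {θ a : ℝ} (h : |θ| ≤ a) : |Real.exp θ - 1| ≤ Real.exp a - 1 := by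
  have h1 : Real.exp θ ≤ Real.exp a := Real.exp_le_exp.2 ((le_abs_self θ).trans h)
  have h2 : Real.exp (-a) ≤ Real.exp θ := Real.exp_le_exp.2 (by linarith [neg_abs_le θ])
  have h3 : Real.exp a * Real.exp (-a) = 1 := by rw [← Real.exp_add]; simp
  rw [abs_le]
  refine ⟨?_, by linarith⟩
  nlinarith [sq_nonneg (Real.exp a - 1), Real.exp_pos a, Real.exp_pos (-a),
    sq_nonneg (Real.exp (-a) - 1), mul_nonneg (Real.exp_pos (-a)).le (sq_nonneg (Real.exp a - 1))]

namespace Rel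

variable {a b z zh w wh : ℝ}

theorem refl (ha : 0 ≤ a) (z : ℝ) : Rel a z z := ⟨0, by simpa, by simp⟩

theorem mono (h : Rel a z zh) (hab : a ≤ b) : Rel b z zh := by
  obtain ⟨θ, h1, h2⟩ := h
  exact ⟨θ, h1.trans hab, h2⟩

theorem trans {y : ℝ} (h : Rel a z zh) (h' : Rel b zh y) : Rel (a + b) z y := by
  obtain ⟨θ, h1, rfl⟩ := h
  obtain ⟨η, h2, rfl⟩ := h'
  exact ⟨θ + η, (abs_add_le _ _).trans (add_le_add h1 h2), by rw [Real.exp_add]; ring⟩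

theorem mul (h : Rel a z zh) (h' : Rel b w wh) : Rel (a + b) (z * w) (zh * wh) := by
  obtain ⟨θ, h1, rfl⟩ := h
  obtain ⟨η, h2, rfl⟩ := h'
  exact ⟨θ + η, (abs_add_le _ _).trans (add_le_add h1 h2), by rw [Real.exp_add]; ring⟩

theorem inv (h : Rel a z zh) : Rel a z⁻¹ zh⁻¹ := by
  obtain ⟨θ, h1, rfl⟩ := h
  exact ⟨-θ, by simpa, by rw [mul_inv, Real.exp_neg]⟩

theorem div (h : Rel a z zh) (h' : Rel b w wh) : Rel (a + b) (z / w) (zh / wh) := by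
  rw [div_eq_mul_inv, div_eq_mul_inv]
  exact h.mul h'.inv

theorem sqrt (h : Rel a z zh) : Rel (a / 2) √z √zh := by
  obtain ⟨θ, h1, rfl⟩ := h
  refine ⟨θ / 2, ?_, ?_⟩
  · rw [abs_div, abs_two]; linarith
  · rw [Real.sqrt_mul' _ (Real.exp_pos θ).le, Real.exp_half]

theorem exp {s sh : ℝ} (h : |sh - s| ≤ a) : Rel a (Real.exp s) (Real.exp sh) :=
  ⟨sh - s, h, by rw [← Real.exp_add]; simp⟩

theorem sum {m : ℕ} {z zh : Fin m → ℝ} (ha : 0 ≤ a) (hz : ∀ i, 0 ≤ z i)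
    (h : ∀ i, Rel a (z i) (zh i)) : Rel a (∑ i, z i) (∑ i, zh i) := by
  have hlo : Real.exp (-a) * ∑ i, z i ≤ ∑ i, zh i := by
    rw [Finset.mul_sum]
    refine Finset.sum_le_sum fun i _ => ?_
    obtain ⟨θ, h1, h2⟩ := h i
    rw [h2, mul_comm]
    exact mul_le_mul_of_nonneg_left (Real.exp_le_exp.2 (abs_le.1 h1).1) (hz i)
  have hhi : ∑ i, zh i ≤ Real.exp a * ∑ i, z i := by
    rw [Finset.mul_sum]
    refine Finset.sum_le_sum fun i _ => ?_
    obtain ⟨θ, h1, h2⟩ := h i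
    rw [h2, mul_comm (Real.exp a)]
    exact mul_le_mul_of_nonneg_left (Real.exp_le_exp.2 (abs_le.1 h1).2) (hz i)
  rcases (Finset.sum_nonneg fun i _ => hz i : 0 ≤ ∑ i, z i).eq_or_lt with h0 | h0
  · rw [← h0] at hlo hhi ⊢
    have : ∑ i, zh i = 0 := by linarith
    rw [this]
    exact refl ha 0
  · have hpos : 0 < ∑ i, zh i := lt_of_lt_of_le (mul_pos (Real.exp_pos _) h0) hlo
    refine ⟨Real.log ((∑ i, zh i) / ∑ i, z i), ?_, ?_⟩
    · rw [abs_le]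
      constructor
      · rw [Real.le_log_iff_exp_le (div_pos hpos h0), le_div_iff₀ h0]
        exact hlo
      · rw [Real.log_le_iff_le_exp (div_pos hpos h0), div_le_iff₀ h0]
        exact hhi
    · rw [Real.exp_log (div_pos hpos h0)]
      field_simp

theorem cl (h : Rel a z zh) : Cl a |z| z zh := by
  obtain ⟨θ, h1, rfl⟩ := h
  refine ⟨le_rfl, ?_⟩
  have : z * Real.exp θ - z = (Real.exp θ - 1) * z := by ring
  rw [this, abs_mul]
  exact mul_le_mul_of_nonneg_right (abs_exp_sub_one_le h1) (abs_nonneg z)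

end Rel

namespace Cl

variable {a b B B' z zh w wh : ℝ}

theorem bound_nonneg (h : Cl a B z zh) : 0 ≤ B := (abs_nonneg z).trans h.1

theorem mono (h : Cl a B z zh) (hab : a ≤ b) (hB : B ≤ B') (ha : 0 ≤ a) : Cl b B' z zh := by
  refine ⟨h.1.trans hB, h.2.trans ?_⟩
  have := Real.exp_le_exp.2 hab
  exact mul_le_mul (by linarith) hB h.bound_nonneg (exp_sub_one_nonneg (ha.trans hab))

theorem mono_left (h : Cl a B z zh) (hab : a ≤ b) : Cl b B z zh := by
  refine ⟨h.1, h.2.trans ?_⟩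
  have := Real.exp_le_exp.2 hab
  exact mul_le_mul_of_nonneg_right (by linarith) h.bound_nonneg

theorem const (ha : 0 ≤ a) (z : ℝ) : Cl a |z| z z := (Rel.refl ha z).cl

/-- The telescoping `ẑŵ - zw = (ẑ - z)ŵ + z(ŵ - w)` with `|ŵ| ≤ e^b B'` gives `(e^a - 1)e^b + (e^b -
1)`, which is exactly `e^(a+b) - 1`. -/
theorem mul (h : Cl a B z zh) (h' : Cl b B' w wh) :
    Cl (a + b) (B * B') (z * w) (zh * wh) := by
  obtain ⟨h1, h2⟩ := h
  obtain ⟨h3, h4⟩ := h'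
  have hB : 0 ≤ B := (abs_nonneg z).trans h1
  have hB' : 0 ≤ B' := (abs_nonneg w).trans h3
  refine ⟨by rw [abs_mul]; exact mul_le_mul h1 h3 (abs_nonneg _) hB, ?_⟩
  have e1 : zh * wh - z * w = (zh - z) * wh + z * (wh - w) := by ring
  have e2 : |wh| ≤ Real.exp b * B' := by
    have := abs_add_le (wh - w) w
    rw [sub_add_cancel] at this
    linarith
  have h5 : |(zh - z) * wh| ≤ (Real.exp a - 1) * B * (Real.exp b * B') := by
    rw [abs_mul]
    exact mul_le_mul h2 e2 (abs_nonneg _) ((abs_nonneg _).trans h2)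
  have h6 : |z * (wh - w)| ≤ B * ((Real.exp b - 1) * B') := by
    rw [abs_mul]
    exact mul_le_mul h1 h4 (abs_nonneg _) hB
  calc _ ≤ _ := by rw [e1]; exact abs_add_le _ _
    _ ≤ _ := add_le_add h5 h6
    _ = _ := by rw [Real.exp_add]; ring

theorem rel (h : Cl a B z zh) {y : ℝ} (h' : Rel b zh y) : Cl (a + b) B z y := by
  obtain ⟨θ, h1, rfl⟩ := h'
  have h2 : Rel b 1 (Real.exp θ) := ⟨θ, h1, by ring⟩
  have := h.mul h2.cl
  simpa using this

theorem add (h : Cl a B z zh) (h' : Cl a B' w wh) : Cl a (B + B') (z + w) (zh + wh) := by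
  refine ⟨(abs_add_le _ _).trans (add_le_add h.1 h'.1), ?_⟩
  have : zh + wh - (z + w) = (zh - z) + (wh - w) := by ring
  rw [this, mul_add]
  exact (abs_add_le _ _).trans (add_le_add h.2 h'.2)

theorem sum {ι : Type*} {s : Finset ι} {B z zh : ι → ℝ} (h : ∀ i ∈ s, Cl a (B i) (z i) (zh i)) :
    Cl a (∑ i ∈ s, B i) (∑ i ∈ s, z i) (∑ i ∈ s, zh i) := by
  refine ⟨(Finset.abs_sum_le_sum_abs _ _).trans (Finset.sum_le_sum fun i hi => (h i hi).1), ?_⟩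
  rw [← Finset.sum_sub_distrib, Finset.mul_sum]
  exact (Finset.abs_sum_le_sum_abs _ _).trans (Finset.sum_le_sum fun i hi => (h i hi).2)

/-- Bernoulli's inequality `ξ (e^a - 1) ≤ e^(ξa) - 1` moves a condition number from the bound into
the exponent. -/
theorem scale {ξ : ℝ} (h : Cl a B z zh) (ha : 0 ≤ a) (hξ : 1 ≤ ξ) (hB : B ≤ ξ * B')
    (hz : |z| ≤ B') : Cl (ξ * a) B' z zh := by
  have hB' : 0 ≤ B' := (abs_nonneg z).trans hz
  refine ⟨hz, h.2.trans ?_⟩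
  have h1 : ξ * (Real.exp a - 1) ≤ Real.exp (ξ * a) - 1 := by
    have := one_add_mul_self_le_rpow_one_add
      (s := Real.exp a - 1) (by linarith [exp_sub_one_nonneg ha]) hξ
    rw [add_sub_cancel, ← Real.exp_mul, mul_comm a ξ] at this
    linarith
  calc _ ≤ (Real.exp a - 1) * (ξ * B') := mul_le_mul_of_nonneg_left hB (exp_sub_one_nonneg ha)
    _ = ξ * (Real.exp a - 1) * B' := by ring
    _ ≤ _ := mul_le_mul_of_nonneg_right h1 hB'

end Cl

theorem exp_sub_one_le_mul {κ a : ℝ} (ha : 0 ≤ a) (hκ : κ ≤ 2) (h : a ≤ (κ - 1) / 4) :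
    Real.exp a - 1 ≤ κ * a := by
  have h1 := (abs_le.1 (Real.abs_exp_sub_one_sub_id_le (x := a)
    (by rw [abs_of_nonneg ha]; linarith))).2
  nlinarith

theorem rel_of_abs_sub_le {c β z zh : ℝ} (hβ0 : 0 ≤ β) (hβ : β < 1)
    (h : |zh - z| ≤ β * |z|) (hc : β ≤ c * (1 - β)) : Rel c z zh := by
  have hc0 : 0 ≤ c := by
    by_contra hneg
    nlinarith
  rcases eq_or_ne z 0 with rfl | hz
  · simp only [abs_zero, mul_zero, sub_zero] at h
    rw [abs_eq_zero.1 (le_antisymm h (abs_nonneg _))]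
    exact Rel.refl hc0 0
  · have h1 : |zh / z - 1| ≤ β := by
      rw [div_sub_one hz, abs_div, div_le_iff₀ (abs_pos.2 hz)]
      exact h
    obtain ⟨h2, h3⟩ := abs_le.1 h1
    have hpos : 0 < zh / z := by linarith
    refine ⟨Real.log (zh / z), ?_, by rw [Real.exp_log hpos]; field_simp⟩
    rw [abs_le]
    constructor
    · have h4 := Real.one_sub_inv_le_log_of_pos hpos
      have h5 : (zh / z)⁻¹ ≤ (1 - β)⁻¹ := inv_anti₀ (by linarith) (by linarith)
      have h6 : (1 - β)⁻¹ ≤ 1 + c := by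
        rw [inv_le_iff_one_le_mul₀ (by linarith)]
        linarith
      linarith
    · have h4 := Real.log_le_sub_one_of_pos hpos
      nlinarith

/-- From `e^a - 1 ≤ a + a²` and `κ ≥ 1 + 4a`, the logarithm of `zh / z` is at most `κ a` in absolute
value. What remains is `a² (2 - 5a - 4a²) ≥ 0`, which holds for `a ≤ 1/4`. -/
theorem Cl.toRel {κ a z zh : ℝ} (h : Cl a |z| z zh) (ha : 0 ≤ a) (hκ : κ ≤ 2)
    (hs : a ≤ (κ - 1) / 4) : Rel (κ * a) z zh := by
  have h1 := (abs_le.1 (Real.abs_exp_sub_one_sub_id_le (x := a)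
    (by rw [abs_of_nonneg ha]; linarith))).2
  have h2 : Real.exp a - 1 ≤ a + a ^ 2 := by linarith
  have ha4 : a ≤ 1 / 4 := by linarith
  refine rel_of_abs_sub_le (β := a + a ^ 2) (by positivity) (by nlinarith) (h.2.trans ?_) ?_
  · exact mul_le_mul_of_nonneg_right h2 (abs_nonneg z)
  · have : (1 + 4 * a) * a * (1 - (a + a ^ 2)) ≤ κ * a * (1 - (a + a ^ 2)) := by
      apply mul_le_mul_of_nonneg_right _ (by nlinarith)
      exact mul_le_mul_of_nonneg_right (by linarith) ha
    have h7 : a + a ^ 2 ≤ (1 + 4 * a) * a * (1 - (a + a ^ 2)) := by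
      have : 0 ≤ a ^ 2 * (2 - 5 * a - 4 * a ^ 2) := mul_nonneg (by positivity) (by nlinarith)
      nlinarith
    linarith

theorem rel_of_abs_sub_le_mul {κ a z zh : ℝ} (h : |zh - z| ≤ a * |z|) (ha : 0 ≤ a) (hκ : κ ≤ 2)
    (hs : a ≤ (κ - 1) / 4) : Rel (κ * a) z zh :=
  Cl.toRel ⟨le_rfl, h.trans (mul_le_mul_of_nonneg_right (by linarith [Real.add_one_le_exp a])
    (abs_nonneg z))⟩ ha hκ hs

theorem Fl.rel {κ u x z : ℝ} (h : Fl u x z) (hκ : κ ≤ 2) (hs : u ≤ (κ - 1) / 4) :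
    Rel (κ * u) x z := by
  obtain ⟨δ, hδ, rfl⟩ := h
  refine rel_of_abs_sub_le_mul ?_ ((abs_nonneg δ).trans hδ) hκ hs
  rw [show x * (1 + δ) - x = δ * x by ring, abs_mul]
  exact mul_le_mul_of_nonneg_right hδ (abs_nonneg x)

/-! ### Rounding errors of the elementary algorithms -/

/-- In an arithmetic with unit roundoff `u`, each operation has an error factor in `[e⁻ᵛ, eᵛ]`. -/
def Rounds (u v : ℝ) : Prop := 0 ≤ v ∧ ∀ x z, Fl u x z → Rel v x z

section

variable {u v : ℝ} (hv : Rounds u v)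
include hv

theorem FlSum.cl {a : ℝ} (ha : 0 ≤ a) : ∀ {m : ℕ} {B x xh : Fin m → ℝ} {z : ℝ},
    FlSum u m xh z → (∀ i, Cl a (B i) (x i) (xh i)) →
      Cl (a + ((m : ℝ) - 1) * v) (∑ i, B i) (∑ i, x i) z
  -- Here the exponent is `a - v`, possibly negative; this is harmless because the bound `B` is an
  -- empty sum.
  | 0, B, x, xh, z, hz, h => by
      simp only [FlSum] at hz
      subst hz
      simp [Cl]
  | 1, B, x, xh, z, hz, h => by
      simp only [FlSum] at hz
      subst hz
      simpa using h 0
  | m + 2, B, x, xh, z, hz, h => by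
      obtain ⟨w, hw, hz⟩ := hz
      have h1 := FlSum.cl ha hw (B := fun i => B i.castSucc) (x := fun i => x i.castSucc)
        fun i => h i.castSucc
      have h2 := (h (Fin.last (m + 1))).mono_left
        (b := a + (((m + 1 : ℕ) : ℝ) - 1) * v) (by
          have := hv.1
          have : 0 ≤ (((m + 1 : ℕ) : ℝ) - 1) * v := by push_cast; simp; positivity
          linarith)
      have h3 := (h1.add h2).rel (hv.2 _ _ hz)
      rw [Fin.sum_univ_castSucc, Fin.sum_univ_castSucc x]
      convert h3 using 1
      push_cast
      ring

/-- Non-negative terms cannot cancel, so the relative error survives summation without a condition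
number. This serves the sum of squares in the norm and the softmax denominator. -/
theorem FlSum.rel {a : ℝ} (ha : 0 ≤ a) : ∀ {m : ℕ} {x xh : Fin (m + 1) → ℝ} {z : ℝ},
    FlSum u (m + 1) xh z → (∀ i, 0 ≤ x i) → (∀ i, Rel a (x i) (xh i)) →
      Rel (a + m * v) (∑ i, x i) z
  | 0, x, xh, z, hz, _, h => by
      simp only [FlSum] at hz
      subst hz
      simpa using h 0
  | m + 1, x, xh, z, hz, hx, h => by
      obtain ⟨w, hw, hz⟩ := hz
      have hv0 := hv.1
      have h1 := FlSum.rel ha hw (x := fun i => x i.castSucc) (fun i => hx _)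
        fun i => h i.castSucc
      have h2 := (h (Fin.last (m + 1))).mono (b := a + m * v) (by
          have : 0 ≤ m * v := by positivity
          linarith)
      have h3 := (Rel.sum (a := a + m * v) (m := 2)
        (z := ![∑ i, x (Fin.castSucc i), x (Fin.last (m + 1))])
        (zh := ![w, xh (Fin.last (m + 1))]) (by positivity)
        (by
          intro i
          fin_cases i
          · exact (Finset.sum_nonneg fun i _ => hx _ : 0 ≤ ∑ i : Fin (m + 1), x i.castSucc)
          · exact hx _)
        (by
          intro i
          fin_cases i
          · exact h1
          · exact h2))
      simp only [Fin.sum_univ_two, Matrix.cons_val_zero, Matrix.cons_val_one] at h3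
      have h4 := h3.trans (hv.2 _ _ hz)
      rw [Fin.sum_univ_castSucc]
      convert h4 using 1
      push_cast
      ring

theorem FlDot.cl {a b : ℝ} (ha : 0 ≤ a) (hb : 0 ≤ b) {m : ℕ} {B B' x xh y yh : Fin m → ℝ} {z : ℝ}
    (hz : FlDot u xh yh z) (hx : ∀ i, Cl a (B i) (x i) (xh i))
    (hy : ∀ i, Cl b (B' i) (y i) (yh i)) :
    Cl (a + b + m * v) (∑ i, B i * B' i) (∑ i, x i * y i) z := by
  obtain ⟨p, hp, hz⟩ := hz
  have hv0 := hv.1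
  have := FlSum.cl hv (by positivity) hz fun i => ((hx i).mul (hy i)).rel (hv.2 _ _ (hp i))
  convert this using 1
  ring

theorem FlMulVec.cl {a : ℝ} (ha : 0 ≤ a) {m n : ℕ} {A : Matrix (Fin m) (Fin n) ℝ}
    {B x xh : Fin n → ℝ} {z : Fin m → ℝ} (hz : FlMulVec u A xh z)
    (hx : ∀ j, Cl a (B j) (x j) (xh j)) (i : Fin m) :
    Cl (a + n * v) ((absMat A *ᵥ B) i) ((A *ᵥ x) i) (z i) := by
  have := FlDot.cl hv le_rfl ha (hz i) (fun j => Cl.const le_rfl (A i j)) hx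
  rw [zero_add] at this
  exact this

theorem FlAffine.cl {a : ℝ} (ha : 0 ≤ a) {m n : ℕ} {A : Matrix (Fin m) (Fin n) ℝ} {b : Fin m → ℝ}
    {B x xh : Fin n → ℝ} {z : Fin m → ℝ} (hz : FlAffine u A b xh z)
    (hx : ∀ j, Cl a (B j) (x j) (xh j)) (i : Fin m) :
    Cl (a + n * v + v) ((absMat A *ᵥ B) i + |b i|) ((A *ᵥ x + b) i) (z i) := by
  obtain ⟨w, hw, hz⟩ := hz
  have hv0 := hv.1
  exact ((FlMulVec.cl hv ha hw hx i).add (Cl.const (by positivity) (b i))).rel (hv.2 _ _ (hz i))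

/-- The numerator contributes `e + 2v`, the sum of squares contributes `2e + dv`, halved by the
square root, and the root and the division contribute `v` each. -/
theorem FlRms.rel {e : ℝ} (he : 0 ≤ e) {d : ℕ} {x xh z : Fin d → ℝ} (hz : FlRms u xh z)
    (hx : ∀ i, Rel e (x i) (xh i)) (i : Fin d) :
    Rel (2 * e + ((d : ℝ) / 2 + 4) * v) (rmsNorm x i) (z i) := by
  obtain ⟨c, q, s, hc, ⟨p, hp, hq⟩, hs, hz⟩ := hz
  obtain ⟨w, hw, hz⟩ := hz i
  have hv0 := hv.1
  obtain ⟨d, rfl⟩ : ∃ d', d = d' + 1 := ⟨d - 1, by have := i.2; omega⟩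
  have h1 := FlSum.rel hv (x := fun i => x i * x i) (by positivity) hq
    (fun i => mul_self_nonneg _) fun i => ((hx i).mul (hx i)).trans (hv.2 _ _ (hp i))
  have h2 := h1.sqrt.trans (hv.2 _ _ hs)
  have h3 := (((((hv.2 _ _ hc).mul (hx i)).trans (hv.2 _ _ hw)).div h2)).trans (hv.2 _ _ hz)
  have h4 : rmsNorm x i = √((d + 1 : ℕ) : ℝ) * x i / √(∑ i, x i * x i) := by
    rw [rmsNorm, EuclideanSpace.norm_eq, mul_div_assoc]
    simp [pow_two]
  rw [h4]
  convert h3 using 1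
  push_cast
  ring

end

/-! ### Exact properties of centring and normalization -/

theorem mean_abs_le_norm {d : ℕ} (x : Fin d → ℝ) : 1 / (d : ℝ) * ∑ i, |x i| ≤ ‖x‖ := by
  rcases Nat.eq_zero_or_pos d with rfl | hd
  · simp
  · have : ∑ i, |x i| ≤ ∑ _i : Fin d, ‖x‖ := Finset.sum_le_sum fun i _ => norm_le_pi_norm x i
    rw [Finset.sum_const, Finset.card_univ, Fintype.card_fin, nsmul_eq_mul] at this
    rw [one_div, inv_mul_le_iff₀ (by positivity)]
    exact this

theorem sum_centr {d : ℕ} (hd : 0 < d) (x : Fin d → ℝ) : ∑ i, centr x i = 0 := by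
  have : (d : ℝ) ≠ 0 := by positivity
  simp only [centr, mean, Finset.sum_sub_distrib, Finset.sum_const, Finset.card_univ,
    Fintype.card_fin, nsmul_eq_mul]
  field_simp
  simp

/-- The numbers `centr x i * mean x` sum to zero, so one of them is non-negative; at that index
adding the mean does not decrease the absolute value. This makes `‖x‖_∞ / ‖centr x‖_{-∞}` at least
one. -/
theorem exists_abs_centr_le_norm {d : ℕ} (hd : 0 < d) (x : Fin d → ℝ) :
    ∃ i, |centr x i| ≤ ‖x‖ := by
  have : Nonempty (Fin d) := ⟨⟨0, hd⟩⟩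
  obtain ⟨i, -, hi⟩ := Finset.exists_le_of_sum_le (s := (Finset.univ : Finset (Fin d)))
    (f := fun _ => 0) (g := fun i => centr x i * mean x) Finset.univ_nonempty
    (by rw [← Finset.sum_mul, sum_centr hd]; simp)
  refine ⟨i, le_trans ?_ (norm_le_pi_norm x i)⟩
  have h1 : x i = centr x i + mean x := by simp [centr]
  rw [Real.norm_eq_abs, h1]
  refine sq_le_sq.1 ?_
  nlinarith [sq_nonneg (mean x)]

theorem layerNorm_eq_rmsNorm_centr {d : ℕ} (x : Fin d → ℝ) :
    layerNorm x = rmsNorm (centr x) := by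
  funext i
  have hd : 0 < (d : ℝ) := by have := i.pos; positivity
  have h1 : √(var x) = ‖WithLp.toLp 2 (centr x)‖ / √(d : ℝ) := by
    rw [EuclideanSpace.norm_eq, ← Real.sqrt_div' _ hd.le, var]
    simp [centr, div_eq_inv_mul]
  rw [layerNorm, rmsNorm, h1]
  simp only [centr]
  rw [div_div_eq_mul_div]
  ring

theorem norm_rmsNorm_le {d : ℕ} (x : Fin d → ℝ) : ‖WithLp.toLp 2 (rmsNorm x)‖ ≤ √(d : ℝ) := by
  have : WithLp.toLp 2 (rmsNorm x) = (√(d : ℝ) * ‖WithLp.toLp 2 x‖⁻¹) • WithLp.toLp 2 x := by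
    ext i
    simp [rmsNorm]
    ring
  rw [this, norm_smul, norm_mul, norm_inv, norm_norm, Real.norm_of_nonneg (Real.sqrt_nonneg _),
    mul_assoc]
  refine mul_le_of_le_one_right (Real.sqrt_nonneg _) ?_
  exact inv_mul_le_one

/-! ### Rounding errors of centring, layer normalization, scores and softmax -/

section

variable {u v : ℝ} (hv : Rounds u v)
include hv

/-- The errors of `x i` and of the mean are both measured against `‖x‖`, hence against `r |centr x
i|`; `scale` then multiplies the exponent by `r`. The remaining summand of `1 + r` pays for the
final subtraction, since `v ≤ d v`. -/
theorem FlCentr.cl {e r : ℝ} (he : 0 ≤ e) {d : ℕ} (hd : 2 ≤ d) {x xh z : Fin d → ℝ}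
    (hz : FlCentr u xh z) (hx : ∀ i, Rel e (x i) (xh i)) (hr : 1 ≤ r)
    (hc : ∀ i, ‖x‖ ≤ r * |centr x i|) (i : Fin d) :
    Cl ((1 + r) * (2 * e + d * v)) |centr x i| (centr x i) (z i) := by
  obtain ⟨s, μ, hs, hμ, hz⟩ := hz
  have hv0 := hv.1
  have hd' : (2 : ℝ) ≤ d := by exact_mod_cast hd
  have h1 := FlSum.cl hv he hs fun i => (hx i).cl
  have h2 := ((Cl.const le_rfl (1 / (d : ℝ))).mul h1).rel (hv.2 _ _ (by
    rw [one_div_mul_eq_div]; exact hμ))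
  have h3 : Cl (e + d * v) ‖x‖ (mean x) μ := by
    have e0 : 0 + (e + ((d : ℝ) - 1) * v) + v = e + d * v := by ring
    rw [e0] at h2
    refine h2.mono le_rfl ?_ (by positivity)
    rw [abs_of_nonneg (by positivity)]
    exact mean_abs_le_norm x
  have h4 : |xh i - x i| ≤ (Real.exp e - 1) * ‖x‖ :=
    (hx i).cl.2.trans (mul_le_mul_of_nonneg_left (norm_le_pi_norm x i) (exp_sub_one_nonneg he))
  have h5 : |xh i - μ - centr x i| ≤ (Real.exp (2 * e + d * v) - 1) * ‖x‖ := by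
    have e1 : xh i - μ - centr x i = (xh i - x i) - (μ - mean x) := by simp [centr]; ring
    have e2 : Real.exp e - 1 + (Real.exp (e + d * v) - 1) ≤ Real.exp (2 * e + d * v) - 1 := by
      have : Real.exp (2 * e + d * v) = Real.exp e * Real.exp (e + d * v) := by
        rw [← Real.exp_add]; ring_nf
      rw [this]
      have h6 := exp_sub_one_nonneg he
      have h7 := exp_sub_one_nonneg (a := e + d * v) (by positivity)
      nlinarith
    calc _ ≤ |xh i - x i| + |μ - mean x| := by rw [e1]; exact abs_sub _ _
      _ ≤ _ := add_le_add h4 h3.2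
      _ ≤ _ := by rw [← add_mul]; exact mul_le_mul_of_nonneg_right e2 (norm_nonneg x)
  have h6 : Cl (2 * e + d * v) (r * |centr x i|) (centr x i) (xh i - μ) := by
    refine ⟨le_mul_of_one_le_left (abs_nonneg _) hr, h5.trans ?_⟩
    exact mul_le_mul_of_nonneg_left (hc i) (exp_sub_one_nonneg (by positivity))
  refine ((h6.scale (by positivity) hr le_rfl le_rfl).rel (hv.2 _ _ (hz i))).mono_left ?_
  nlinarith

theorem FlLayerNorm.rel {κ e r : ℝ} (he : 0 ≤ e) {d : ℕ} (hd : 2 ≤ d) {x xh z : Fin d → ℝ}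
    (hz : FlLayerNorm u xh z) (hx : ∀ i, Rel e (x i) (xh i)) (hr : 1 ≤ r)
    (hc : ∀ i, ‖x‖ ≤ r * |centr x i|) (hκ1 : 1 ≤ κ) (hκ : κ ≤ 2)
    (hs : (1 + r) * (2 * e + d * v) ≤ (κ - 1) / 4) (i : Fin d) :
    Rel (κ * (1 + r) * (4 * e + (9 / 4 * d + 2) * v)) (layerNorm x i) (z i) := by
  obtain ⟨y, hy, hz⟩ := hz
  have hv0 := hv.1
  have h1 := fun i => (FlCentr.cl hv he hd hy hx hr hc i).toRel (by positivity) hκ hs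
  rw [layerNorm_eq_rmsNorm_centr]
  refine (FlRms.rel hv (by positivity) hz h1 i).mono ?_
  -- The rounding part `(d/2 + 4) v` of `FlRms.rel` lacks the factor `κ (1 + r)`. As this factor is
  -- at least two, `(d/4 + 2) v` inside it suffices, which gives `2d + d/4 + 2 = 9/4 d + 2`.
  have h2 : 2 ≤ κ * (1 + r) := by nlinarith
  have h3 : 0 ≤ ((d : ℝ) / 4 + 2) * v := by positivity
  nlinarith

theorem FlScores.cl {a : ℝ} (ha : 0 ≤ a) {d m : ℕ} {Θ : Config d}
    {X Xh : Matrix (Fin d) (Fin (m + 1)) ℝ} {s : Fin (m + 1) → ℝ} (hs : FlScores u Θ Xh s)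
    (hX : ∀ i t, Rel a (X i t) (Xh i t)) (t : Fin (m + 1)) :
    Cl (2 * a + (3 * d + 2) * v)
      ((1 / √(d : ℝ)) * ((absMat Θ.Wk *ᵥ absVec (X.col t)) ⬝ᵥ
        (absMat Θ.Wq *ᵥ absVec (X.col (Fin.last m))))) (scores Θ X t) (s t) := by
  obtain ⟨c, q, hc, hq, hs⟩ := hs
  obtain ⟨k, w, hk, hw, hs⟩ := hs t
  have hv0 := hv.1
  have h1 := FlMulVec.cl hv ha hq fun j => (hX j (Fin.last m)).cl
  have h2 := FlMulVec.cl hv ha hk fun j => (hX j t).cl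
  have h3 := FlDot.cl hv (by positivity) (by positivity) hw h2 h1
  have h4 := (hv.2 _ _ hc).inv
  have h5 := (h4.cl.mul h3).rel (hv.2 _ _ (by rw [inv_mul_eq_div]; exact hs))
  rw [abs_of_nonneg (by positivity), ← one_div] at h5
  have h6 : 2 * a + (3 * d + 2) * v = v + (a + d * v + (a + d * v) + d * v) + v := by ring
  rw [h6]
  exact h5

/-- A shift by at most `Δ` in the scores is a factor in `[e^(-Δ), e^Δ]` for each exponential, and
also for their positive sum; the quotient doubles it. -/
theorem FlSoftmax.rel {Δ : ℝ} {m : ℕ} {s sh z : Fin (m + 1) → ℝ} (hz : FlSoftmax u sh z)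
    (hs : ∀ i, |sh i - s i| ≤ Δ) (i : Fin (m + 1)) :
    Rel (2 * Δ + ((m + 1 : ℕ) + 2) * v) (softmax s i) (z i) := by
  obtain ⟨e, S, he, hS, hz⟩ := hz
  have hv0 := hv.1
  have hΔ : 0 ≤ Δ := (abs_nonneg _).trans (hs i)
  have h1 := fun i => (Rel.exp (hs i)).trans (hv.2 _ _ (he i))
  have h2 := FlSum.rel hv (by positivity) hS (fun i => (Real.exp_pos (s i)).le) h1
  have h3 := ((h1 i).div h2).trans (hv.2 _ _ (hz i))
  have h4 : 2 * Δ + ((m + 1 : ℕ) + 2) * v = Δ + v + (Δ + v + m * v) + v := by push_cast; ring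
  rw [h4]
  exact h3

end

/-! ### Rounding errors of the sub-blocks -/

theorem norm_absVec {d : ℕ} (x : Fin d → ℝ) :
    ‖WithLp.toLp 2 (absVec x)‖ = ‖WithLp.toLp 2 x‖ := by
  simp [EuclideanSpace.norm_eq, absVec]

/-- The inner product is the bilinear form of `|W_k|ᵀ|W_q|` at `|x|` and `|y|`, so it is at most `d
σ_max`; the scaling leaves `√d σ_max`. -/
theorem abs_scores_bound {d : ℕ} (Θ : Config d) {x y : Fin d → ℝ}
    (hx : ‖WithLp.toLp 2 x‖ ≤ √(d : ℝ)) (hy : ‖WithLp.toLp 2 y‖ ≤ √(d : ℝ)) :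
    (1 / √(d : ℝ)) * ((absMat Θ.Wk *ᵥ absVec x) ⬝ᵥ (absMat Θ.Wq *ᵥ absVec y)) ≤
      √(d : ℝ) * sigmaMax ((absMat Θ.Wk)ᵀ * absMat Θ.Wq) := by
  have h1 := dotProduct_mulVec_le_sigmaMax ((absMat Θ.Wk)ᵀ * absMat Θ.Wq) (absVec x) (absVec y)
  rw [norm_absVec, norm_absVec, ← Matrix.mulVec_mulVec, Matrix.dotProduct_mulVec,
    Matrix.vecMul_transpose] at h1
  have h0 := sigmaMax_nonneg ((absMat Θ.Wk)ᵀ * absMat Θ.Wq)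
  have h2 := h1.trans (mul_le_mul_of_nonneg_left
    (mul_le_mul hx hy (norm_nonneg _) (Real.sqrt_nonneg _)) h0)
  rcases (Real.sqrt_nonneg (d : ℝ)).eq_or_lt with hd | hd
  · rw [← hd]; simp
  · rw [one_div, inv_mul_le_iff₀ hd]
    linarith

theorem softmax_nonneg {m : ℕ} (s : Fin m → ℝ) (i : Fin m) : 0 ≤ softmax s i :=
  div_nonneg (Real.exp_pos _).le (Finset.sum_nonneg fun _ _ => (Real.exp_pos _).le)

section

variable {u v : ℝ} (hv : Rounds u v)
include hv

theorem FlAttention.cl {a κ : ℝ} (ha : 0 ≤ a) {d n : ℕ} {Θ : Config d}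
    (hd : 0 < d) (hW : IsUnit (Θ.Wkᵀ * Θ.Wq))
    {X Xh A : Matrix (Fin d) (Fin n) ℝ} (hA : FlAttention u Θ Xh A)
    (hX : ∀ i t, Rel a (X i t) (Xh i t)) (hn : ∀ t, ‖WithLp.toLp 2 (X.col t)‖ ≤ √(d : ℝ))
    (hκ1 : 1 ≤ κ) (hκ : κ ≤ 2) (hs : 2 * a + (3 * d + 2) * v ≤ (κ - 1) / 4)
    (i : Fin d) (t : Fin n) :
    Cl (κ * attnFactor Θ * (a + (2 * n + 3 / 2 * d + 2) * v))
      ((absMat Θ.Wv *ᵥ (absMat (firstCols X t) *ᵥ probs Θ X t)) i)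
      (attention Θ X i t) (A i t) := by
  obtain ⟨s, p, w, hsc, hp, hw, hA⟩ := hA t
  have hv0 := hv.1
  set σ := sigmaMax ((absMat Θ.Wk)ᵀ * absMat Θ.Wq)
  have hσ : 0 ≤ σ := sigmaMax_nonneg _
  have hE : 0 ≤ 2 * a + (3 * d + 2) * v := by positivity
  have h1 : ∀ i, |s i - scores Θ (firstCols X t) i| ≤
      κ * (2 * a + (3 * d + 2) * v) * (√(d : ℝ) * σ) := fun i => by
    have h2 := FlScores.cl hv ha hsc (X := firstCols X t) (fun i j => hX _ _) i
    refine h2.2.trans (mul_le_mul (exp_sub_one_le_mul hE hκ hs) ?_ h2.bound_nonneg (by positivity))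
    exact abs_scores_bound Θ (hn _) (hn _)
  have h2 := fun i => (FlSoftmax.rel hv hp h1 i).cl
  have h3 : ∀ j, Cl (a + (2 * (κ * (2 * a + (3 * d + 2) * v) * (√(d : ℝ) * σ)) +
      (((t : ℕ) + 1 : ℕ) + 2) * v) + ((t : ℕ) + 1 : ℕ) * v)
      ((absMat (firstCols X t) *ᵥ probs Θ X t) j) ((firstCols X t *ᵥ probs Θ X t) j) (w j) :=
    fun j => by
      have h4 := FlDot.cl hv ha (by positivity) (hw j) (fun k => (hX j (Fin.castLE t.isLt k)).cl) h2
      simp only [abs_of_nonneg (softmax_nonneg _ _)] at h4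
      exact h4
  have h4 := FlMulVec.cl hv (by positivity) hA h3 i
  refine h4.mono_left ?_
  have hK := one_add_le_attnFactor hd Θ hW
  have ht : (((t : ℕ) + 1 : ℕ) : ℝ) ≤ n := by exact_mod_cast t.isLt
  have ht0 : (1 : ℝ) ≤ (((t : ℕ) + 1 : ℕ) : ℝ) := by simp
  set m : ℝ := (((t : ℕ) + 1 : ℕ) : ℝ)
  set S := √(d : ℝ) * σ
  have hS : 0 ≤ S := by positivity
  have h5 : κ * (1 + 4 * S) * (a + (2 * n + 3 / 2 * d + 2) * v) ≤
      κ * attnFactor Θ * (a + (2 * n + 3 / 2 * d + 2) * v) := by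
    refine mul_le_mul_of_nonneg_right (mul_le_mul_of_nonneg_left ?_ (by linarith)) (by positivity)
    simp only [S]; linarith
  refine le_trans ?_ h5
  have h6 : (m + 2) * v + m * v + d * v ≤ (2 * n + 3 / 2 * d + 2) * v := by
    have : (m + 2 + m + d) * v ≤ (2 * n + 3 / 2 * d + 2) * v := by
      refine mul_le_mul_of_nonneg_right ?_ hv0
      have : (0 : ℝ) ≤ d := by positivity
      linarith
    linarith
  have h7 : a + (m + 2) * v + m * v + d * v ≤ κ * (a + (2 * n + 3 / 2 * d + 2) * v) := by
    have : 0 ≤ a + (2 * n + 3 / 2 * d + 2) * v := by positivity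
    nlinarith
  -- Twice the score exponent is `4 (a + (3/2 d + 1) v)`: this is the origin of the 4 in
  -- `attnFactor` and of `3/2 d`. The term `2n` comes from the softmax and the product with its
  -- output.
  have h8 : κ * S * (2 * (2 * a + (3 * d + 2) * v)) ≤
      κ * S * (4 * (a + (2 * n + 3 / 2 * d + 2) * v)) := by
    refine mul_le_mul_of_nonneg_left ?_ (by positivity)
    have : (1 : ℝ) * v ≤ n * v := mul_le_mul_of_nonneg_right (ht0.trans ht) hv0
    nlinarith
  nlinarith

theorem FlAttnBlock.cl {a e κ ξA ξF : ℝ} (he : 0 ≤ e) (hea : e ≤ a) {d n : ℕ} {Θ : Config d}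
    (hd : 0 < d) (hW : IsUnit (Θ.Wkᵀ * Θ.Wq))
    {ν : (Fin d → ℝ) → (Fin d → ℝ)} {flν : (Fin d → ℝ) → (Fin d → ℝ) → Prop}
    {X Xh Y : Matrix (Fin d) (Fin n) ℝ} (hY : FlAttnBlock flν u Θ Xh Y)
    (hX : ∀ i t, Rel e (X i t) (Xh i t))
    (hν : ∀ t z, flν (Xh.col t) z → ∀ i, Rel a (ν (X.col t) i) (z i))
    (hn : ∀ x, ‖WithLp.toLp 2 (ν x)‖ ≤ √(d : ℝ))
    (hκ1 : 1 ≤ κ) (hκ : κ ≤ 2) (hs : 2 * a + (3 * d + 2) * v ≤ (κ - 1) / 4)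
    (hξA : 1 ≤ ξA) (hξF : 1 ≤ ξF)
    (hA : ∀ i t, (absMat Θ.Wv *ᵥ (absMat (firstCols (colMap ν X) t) *ᵥ
      probs Θ (colMap ν X) t)) i ≤ ξA * |attention Θ (colMap ν X) i t|)
    (hF : ∀ i t, |X i t| + |attention Θ (colMap ν X) i t| ≤ ξF * |attnBlock ν Θ X i t|)
    (i : Fin d) (t : Fin n) :
    Cl (ξF * (ξA * (κ * attnFactor Θ * (a + (2 * n + 3 / 2 * d + 2) * v))) + v)
      |attnBlock ν Θ X i t| (attnBlock ν Θ X i t) (Y i t) := by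
  obtain ⟨R, A, hR, hAt, hY⟩ := hY
  have hv0 := hv.1
  have ha : 0 ≤ a := he.trans hea
  have hK := one_le_attnFactor hd Θ hW
  have h1 := FlAttention.cl hv ha hd hW hAt (X := colMap ν X) (fun i t => hν t _ (hR t) i)
    (fun t => hn _) hκ1 hκ hs i t
  have hE : a ≤ κ * attnFactor Θ * (a + (2 * n + 3 / 2 * d + 2) * v) := by
    have h2 : 1 ≤ κ * attnFactor Θ := one_le_mul_of_one_le_of_one_le hκ1 hK
    have h3 : 0 ≤ (2 * n + 3 / 2 * d + 2) * v := by positivity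
    nlinarith
  set E := κ * attnFactor Θ * (a + (2 * n + 3 / 2 * d + 2) * v)
  have hE0 : 0 ≤ E := ha.trans hE
  have h2 := h1.scale hE0 hξA (hA i t) le_rfl
  have h3 := (hX i t).cl.mono_left (b := ξA * E) (by nlinarith)
  exact ((h3.add h2).scale (by positivity) hξF (hF i t) le_rfl).rel (hv.2 _ _ (hY i t))

theorem FlTlp.cl {a : ℝ} (ha : 0 ≤ a) {d : ℕ} {Θ : Config d} {x xh z : Fin d → ℝ}
    (hz : FlTlp u Θ xh z) (hx : ∀ i, Rel a (x i) (xh i))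
    (hsign : ∀ k, (Real.exp (a + d * v + v) - 1) * ((absMat Θ.A₁ *ᵥ absVec x) k + |Θ.b₁ k|) <
      |layer₁ Θ x k|) (i : Fin d) :
    Cl (a + (d + Θ.D + 2) * v)
      ((∑ k with 0 < layer₁ Θ x k,
        |Θ.A₂ i k| * ((absMat Θ.A₁ *ᵥ absVec x) k + |Θ.b₁ k|)) + |Θ.b₂ i|)
      (tlp Θ x i) (z i) := by
  obtain ⟨y, hy, hz⟩ := hz
  have hv0 := hv.1
  have h1 : ∀ k, Cl (a + d * v + v) ((absMat Θ.A₁ *ᵥ absVec x) k + |Θ.b₁ k|) (layer₁ Θ x k) (y k) :=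
    FlAffine.cl hv ha hy fun j => (hx j).cl
  -- The sign condition makes exact and computed entries lie on the same side of zero. On the
  -- negative side both ReLU values vanish, so the bound may be zero there; this restricts the sum
  -- in `xiTlp` to the positive support.
  have h2 : ∀ k, Cl (a + d * v + v)
      (if 0 < layer₁ Θ x k then (absMat Θ.A₁ *ᵥ absVec x) k + |Θ.b₁ k| else 0)
      (relu (layer₁ Θ x) k) (relu y k) := fun k => by
    have h3 := (h1 k).2.trans_lt (hsign k)
    split_ifs with hk
    · rw [abs_of_pos hk, abs_lt] at h3
      simp only [relu]
      rw [max_eq_right hk.le, max_eq_right (by linarith)]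
      exact h1 k
    · rw [abs_of_nonpos (not_lt.1 hk), abs_lt] at h3
      simp only [relu]
      rw [max_eq_left (not_lt.1 hk), max_eq_left (by linarith)]
      simp [Cl]
  have h3 := FlAffine.cl hv (by positivity) hz h2 i
  have h4 : a + (d + Θ.D + 2) * v = a + d * v + v + Θ.D * v + v := by ring
  have h5 : (∑ k with 0 < layer₁ Θ x k,
        |Θ.A₂ i k| * ((absMat Θ.A₁ *ᵥ absVec x) k + |Θ.b₁ k|)) =
      (absMat Θ.A₂ *ᵥ fun k =>
        if 0 < layer₁ Θ x k then (absMat Θ.A₁ *ᵥ absVec x) k + |Θ.b₁ k| else 0) i := by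
    rw [Matrix.mulVec, dotProduct, Finset.sum_filter]
    refine Finset.sum_congr rfl fun k _ => ?_
    simp [absMat]
  rw [h4, h5]
  exact h3

theorem FlTlpBlock.cl {a e ξM ξF : ℝ} (he : 0 ≤ e) (hea : e ≤ a) {d : ℕ} {Θ : Config d}
    {ν : (Fin d → ℝ) → (Fin d → ℝ)} {flν : (Fin d → ℝ) → (Fin d → ℝ) → Prop}
    {x xh z : Fin d → ℝ} (hz : FlTlpBlock flν u Θ xh z) (hx : ∀ i, Rel e (x i) (xh i))
    (hν : ∀ z, flν xh z → ∀ i, Rel a (ν x i) (z i))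
    (hsign : ∀ k, (Real.exp (a + d * v + v) - 1) *
      ((absMat Θ.A₁ *ᵥ absVec (ν x)) k + |Θ.b₁ k|) < |layer₁ Θ (ν x) k|)
    (hξM : 1 ≤ ξM) (hξF : 1 ≤ ξF)
    (hM : ∀ i, (∑ k with 0 < layer₁ Θ (ν x) k,
        |Θ.A₂ i k| * ((absMat Θ.A₁ *ᵥ absVec (ν x)) k + |Θ.b₁ k|)) + |Θ.b₂ i| ≤
          ξM * |tlp Θ (ν x) i|)
    (hF : ∀ i, |x i| + |tlp Θ (ν x) i| ≤ ξF * |tlpBlock ν Θ x i|) (i : Fin d) :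
    Cl (ξF * (ξM * (a + (d + Θ.D + 2) * v)) + v)
      |tlpBlock ν Θ x i| (tlpBlock ν Θ x i) (z i) := by
  obtain ⟨r, m, hr, hm, hz⟩ := hz
  have hv0 := hv.1
  have ha : 0 ≤ a := he.trans hea
  have h1 := (FlTlp.cl hv ha hm (hν r hr) hsign i).scale (by positivity) hξM (hM i) le_rfl
  have h2 := (hx i).cl.mono_left (b := ξM * (a + (d + Θ.D + 2) * v)) (by
    have : 0 ≤ (d + Θ.D + 2) * v := by positivity
    nlinarith)
  exact ((h2.add h1).scale (by positivity) hξF (hF i) le_rfl).rel (hv.2 _ _ (hz i))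

end

/-! ### Rounding errors of the transformer blocks -/

/-- On inputs with relative error `e`, the computed normalization `flν` of `x` has relative error
`F (c₁ e + c₂ v)`, up to a factor close to one. -/
def NormRel {d : ℕ} (ν : (Fin d → ℝ) → (Fin d → ℝ))
    (flν : ℝ → (Fin d → ℝ) → (Fin d → ℝ) → Prop) (c₁ c₂ F : ℝ) (x : Fin d → ℝ) : Prop :=
  ∀ κ u v e : ℝ, Rounds u v → 1 ≤ κ → κ ≤ 2 → 0 ≤ e → F * (c₁ * e + c₂ * v) ≤ (κ - 1) / 4 →
    ∀ xh z : Fin d → ℝ, (∀ i, Rel e (x i) (xh i)) → flν u xh z →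
      ∀ i, Rel (κ * (F * (c₁ * e + c₂ * v))) (ν x i) (z i)

theorem normRel_rmsNorm {d : ℕ} (x : Fin d → ℝ) :
    NormRel rmsNorm (fun u => FlRms u) 2 ((d : ℝ) / 2 + 4) 1 x := by
  intro κ u v e hv hκ1 _ he _ xh z hx hz i
  have hv0 := hv.1
  refine (FlRms.rel hv he hz hx i).mono ?_
  rw [one_mul]
  exact le_mul_of_one_le_left (by positivity) hκ1

theorem normRel_layerNorm {d : ℕ} (hd : 2 ≤ d) {r : ℝ} {x : Fin d → ℝ} (hr : 1 ≤ r)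
    (hc : ∀ i, ‖x‖ ≤ r * |centr x i|) :
    NormRel layerNorm (fun u => FlLayerNorm u) 4 (9 / 4 * d + 2) (1 + r) x := by
  intro κ u v e hv hκ1 hκ he hs xh z hx hz i
  have hv0 := hv.1
  rw [← mul_assoc]
  refine FlLayerNorm.rel hv he hd hz hx hr hc hκ1 hκ (le_trans ?_ hs) i
  refine mul_le_mul_of_nonneg_left ?_ (by linarith)
  have : 0 ≤ (5 / 4 * (d : ℝ) + 2) * v := by positivity
  linarith

/-- A transformer block with normalization `ν`. -/
def block {d n : ℕ} (ν : (Fin d → ℝ) → (Fin d → ℝ)) (Θ : Config d)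
    (X : Matrix (Fin d) (Fin n) ℝ) : Matrix (Fin d) (Fin n) ℝ :=
  colMap (tlpBlock ν Θ) (attnBlock ν Θ X)

/-- `Z` is a computed value of `block ν Θ X`. -/
def FlBlock {d n : ℕ} (flν : ℝ → (Fin d → ℝ) → (Fin d → ℝ) → Prop) (u : ℝ) (Θ : Config d)
    (X Z : Matrix (Fin d) (Fin n) ℝ) : Prop :=
  ∃ Y : Matrix (Fin d) (Fin n) ℝ, FlAttnBlock (flν u) u Θ X Y ∧
    ∀ t, FlTlpBlock (flν u) u Θ (Y.col t) (Z.col t)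

/-- The assumptions that determine the error bound for a block, with real condition numbers. -/
structure BlockData {d n : ℕ} (ν : (Fin d → ℝ) → (Fin d → ℝ))
    (flν : ℝ → (Fin d → ℝ) → (Fin d → ℝ) → Prop) (Θ : Config d) (X : Matrix (Fin d) (Fin n) ℝ)
    (c₁ c₂ FX FY ξA ξF P : ℝ) (ξM ξG : Fin n → ℝ) : Prop where
  hd : 2 ≤ d
  hW : IsUnit (Θ.Wkᵀ * Θ.Wq)
  hc₁ : 1 ≤ c₁
  hc₂ : 0 ≤ c₂
  hFX : 1 ≤ FX
  hFY : 1 ≤ FY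
  hξA : 1 ≤ ξA
  hξF : 1 ≤ ξF
  hP : 1 ≤ P
  hξM : ∀ t, 1 ≤ ξM t
  hξG : ∀ t, 1 ≤ ξG t
  hMG : ∀ t, ξG t * ξM t ≤ P
  norm_le : ∀ x, ‖WithLp.toLp 2 (ν x)‖ ≤ √(d : ℝ)
  relX : ∀ t, NormRel ν flν c₁ c₂ FX (X.col t)
  relY : ∀ t, NormRel ν flν c₁ c₂ FY ((attnBlock ν Θ X).col t)
  leA : ∀ i t, (absMat Θ.Wv *ᵥ (absMat (firstCols (colMap ν X) t) *ᵥ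
    probs Θ (colMap ν X) t)) i ≤ ξA * |attention Θ (colMap ν X) i t|
  leF : ∀ i t, |X i t| + |attention Θ (colMap ν X) i t| ≤ ξF * |attnBlock ν Θ X i t|
  leM : ∀ t i, (∑ k with 0 < layer₁ Θ (ν ((attnBlock ν Θ X).col t)) k,
      |Θ.A₂ i k| * ((absMat Θ.A₁ *ᵥ absVec (ν ((attnBlock ν Θ X).col t))) k + |Θ.b₁ k|)) +
        |Θ.b₂ i| ≤ ξM t * |tlp Θ (ν ((attnBlock ν Θ X).col t)) i|
  leG : ∀ t i, |(attnBlock ν Θ X).col t i| + |tlp Θ (ν ((attnBlock ν Θ X).col t)) i| ≤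
    ξG t * |tlpBlock ν Θ ((attnBlock ν Θ X).col t) i|
  layer₁_ne : ∀ t k, layer₁ Θ (ν ((attnBlock ν Θ X).col t)) k ≠ 0

theorem absMat_mulVec_absVec_add_nonneg {m d : ℕ} (A : Matrix (Fin m) (Fin d) ℝ) (b : Fin m → ℝ)
    (x : Fin d → ℝ) (k : Fin m) : 0 ≤ (absMat A *ᵥ absVec x) k + |b k| := by
  change 0 ≤ (∑ j, |A k j| * |x j|) + |b k|
  exact add_nonneg (Finset.sum_nonneg fun j _ => mul_nonneg (abs_nonneg (A k j)) (abs_nonneg (x j)))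
    (abs_nonneg _)

namespace BlockData

variable {d n : ℕ} {ν : (Fin d → ℝ) → (Fin d → ℝ)}
  {flν : ℝ → (Fin d → ℝ) → (Fin d → ℝ) → Prop} {Θ : Config d} {X : Matrix (Fin d) (Fin n) ℝ}
  {c₁ c₂ FX FY ξA ξF P : ℝ} {ξM ξG : Fin n → ℝ}

set_option maxHeartbeats 1000000 in
/-- Error bound for a block in which all higher-order terms are absorbed by powers of `κ`. -/
theorem abs_sub_le (h : BlockData ν flν Θ X c₁ c₂ FX FY ξA ξF P ξM ξG) {κ u ε T : ℝ}
    (hκ1 : 1 ≤ κ) (hκ : κ ≤ 2) (hu : 0 ≤ u) (hε : 0 ≤ ε)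
    (hT : T = P * FY * (attnFactor Θ * FX * ξF * ξA) *
      ((c₁ * (c₂ + 2 * n + 3 / 2 * d + 3) + c₂ + d + Θ.D + 3) * u + c₁ ^ 2 * ε))
    (hs : κ ^ 5 * T ≤ (κ - 1) / 8)
    (hsign : ∀ t k, (Real.exp (κ ^ 5 * T) - 1) *
      ((absMat Θ.A₁ *ᵥ absVec (ν ((attnBlock ν Θ X).col t))) k + |Θ.b₁ k|) <
        |layer₁ Θ (ν ((attnBlock ν Θ X).col t)) k|)
    {Xh Z : Matrix (Fin d) (Fin n) ℝ} (hX : ∀ i t, |Xh i t - X i t| ≤ ε * |X i t|)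
    (hZ : FlBlock flν u Θ Xh Z) (i : Fin d) (t : Fin n) :
    |Z i t - block ν Θ X i t| ≤ κ ^ 6 * T * |block ν Θ X i t| := by
  obtain ⟨Y, hY, hZ⟩ := hZ
  have hd0 : 0 < d := by have := h.hd; omega
  have hK := one_le_attnFactor hd0 Θ h.hW
  have hc₁ := h.hc₁
  have hc₂ := h.hc₂
  have hFX := h.hFX
  have hFY := h.hFY
  have hξA := h.hξA
  have hξF := h.hξF
  have hP := h.hP
  have hM := h.hξM t
  have hG := h.hξG t
  have hMG := h.hMG t
  have hn1 : (1 : ℝ) ≤ n := by exact_mod_cast Nat.one_le_of_lt t.isLt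
  have hκ0 : 0 ≤ κ := by linarith
  set K := attnFactor Θ
  obtain ⟨v, hv⟩ : ∃ v, v = κ * u := ⟨_, rfl⟩
  obtain ⟨e, he⟩ : ∃ e, e = κ * ε := ⟨_, rfl⟩
  obtain ⟨s₁, hs₁⟩ : ∃ s, s = FX * (c₁ * e + c₂ * v) := ⟨_, rfl⟩
  obtain ⟨a₁, ha₁⟩ : ∃ a, a = κ * s₁ := ⟨_, rfl⟩
  obtain ⟨EA, hEA⟩ : ∃ E, E = κ * K * (a₁ + (2 * n + 3 / 2 * d + 2) * v) := ⟨_, rfl⟩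
  obtain ⟨b, hb⟩ : ∃ b, b = ξF * (ξA * EA) + v := ⟨_, rfl⟩
  obtain ⟨eY, heY⟩ : ∃ e, e = κ * b := ⟨_, rfl⟩
  obtain ⟨s₂, hs₂⟩ : ∃ s, s = FY * (c₁ * eY + c₂ * v) := ⟨_, rfl⟩
  obtain ⟨a₂, ha₂⟩ : ∃ a, a = κ * s₂ := ⟨_, rfl⟩
  obtain ⟨E₂, hE₂⟩ : ∃ E, E = a₂ + (d + Θ.D + 2) * v := ⟨_, rfl⟩
  obtain ⟨bZ, hbZ⟩ : ∃ b, b = ξG t * (ξM t * E₂) + v := ⟨_, rfl⟩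
  have hv0 : 0 ≤ v := by rw [hv]; positivity
  have he0 : 0 ≤ e := by rw [he]; positivity
  have hs₁0 : 0 ≤ s₁ := by rw [hs₁]; positivity
  have ha₁0 : 0 ≤ a₁ := by rw [ha₁]; positivity
  have hEA0 : 0 ≤ EA := by rw [hEA]; positivity
  have hb0 : 0 ≤ b := by rw [hb]; positivity
  have heY0 : 0 ≤ eY := by rw [heY]; positivity
  have hs₂0 : 0 ≤ s₂ := by rw [hs₂]; positivity
  have ha₂0 : 0 ≤ a₂ := by rw [ha₂]; positivity
  have hE₂0 : 0 ≤ E₂ := by rw [hE₂]; positivity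
  -- The next inequalities place the intermediate error exponents below the final one, `bZ`, so
  -- smallness of `κ^5 T` covers every conversion. The bound `(κ - 1)/8`, not `/4`, is needed
  -- because the score exponent is only below `2 EA`.
  have l1 : u ≤ v := by rw [hv]; exact le_mul_of_one_le_left hu hκ1
  have l2 : ε ≤ e := by rw [he]; exact le_mul_of_one_le_left hε hκ1
  have l3 : e ≤ s₁ := by
    rw [hs₁]
    refine le_trans ?_ (le_mul_of_one_le_left (by positivity) hFX)
    have : 0 ≤ c₂ * v := by positivity
    have := le_mul_of_one_le_left he0 hc₁
    linarith
  have l4 : s₁ ≤ a₁ := by rw [ha₁]; exact le_mul_of_one_le_left hs₁0 hκ1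
  have l5 : a₁ + (2 * n + 3 / 2 * d + 2) * v ≤ EA := by
    rw [hEA]
    exact le_mul_of_one_le_left (by positivity) (one_le_mul_of_one_le_of_one_le hκ1 hK)
  have l5a : a₁ ≤ EA := by
    have : 0 ≤ (2 * n + 3 / 2 * d + 2) * v := by positivity
    linarith
  have l5b : 2 * a₁ + (3 * d + 2) * v ≤ 2 * EA := by
    have : 0 ≤ (4 * n + 2) * v := by positivity
    linarith
  have l6 : EA ≤ b := by
    rw [hb]
    have h1 := le_mul_of_one_le_left hEA0 hξA
    have h2 := le_mul_of_one_le_left (hEA0.trans h1) hξF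
    linarith
  have l7 : b ≤ eY := by rw [heY]; exact le_mul_of_one_le_left hb0 hκ1
  have l8 : eY ≤ s₂ := by
    rw [hs₂]
    refine le_trans ?_ (le_mul_of_one_le_left (by positivity) hFY)
    have : 0 ≤ c₂ * v := by positivity
    have := le_mul_of_one_le_left heY0 hc₁
    linarith
  have l9 : s₂ ≤ a₂ := by rw [ha₂]; exact le_mul_of_one_le_left hs₂0 hκ1
  have l10 : a₂ + (d + Θ.D + 2) * v ≤ bZ := by
    rw [hbZ, ← hE₂]
    have h1 := le_mul_of_one_le_left hE₂0 hM
    have h2 := le_mul_of_one_le_left (hE₂0.trans h1) hG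
    linarith
  have l11 : 0 ≤ (d + Θ.D) * v := by positivity
  have l12 : 0 ≤ (Θ.D + 1) * v := by positivity
  have hbZ0 : 0 ≤ bZ := by linarith
  -- Powers of `κ` count conversions: one for the inputs `u` and `ε`, one for each of the two
  -- normalizations, one for the scores and one for the intermediate matrix. The sixth power comes
  -- from `e^bZ - 1 ≤ κ bZ` at the end.
  have u1 : EA ≤ κ ^ 3 * (K * FX) * (c₁ * ε + (c₂ + 2 * n + 3 / 2 * d + 2) * u) := by
    have h1 : (2 * n + 3 / 2 * d + 2) * v ≤ κ ^ 2 * FX * ((2 * n + 3 / 2 * d + 2) * u) := by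
      have : κ ≤ κ ^ 2 * FX := by nlinarith
      calc _ = κ * ((2 * n + 3 / 2 * d + 2) * u) := by rw [hv]; ring
        _ ≤ _ := mul_le_mul_of_nonneg_right this (by positivity)
    calc EA ≤ κ * K * (a₁ + κ ^ 2 * FX * ((2 * n + 3 / 2 * d + 2) * u)) := by
          rw [hEA]
          exact mul_le_mul_of_nonneg_left (by linarith) (by positivity)
      _ = _ := by rw [ha₁, hs₁, he, hv]; ring
  obtain ⟨q, hq⟩ : ∃ q, q = c₁ * ε + (c₂ + 2 * n + 3 / 2 * d + 3) * u := ⟨_, rfl⟩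
  obtain ⟨H, hH⟩ : ∃ H, H = K * FX * ξF * ξA := ⟨_, rfl⟩
  have hq0 : 0 ≤ q := by rw [hq]; positivity
  have hH1 : 1 ≤ H := by
    rw [hH]
    exact one_le_mul_of_one_le_of_one_le (one_le_mul_of_one_le_of_one_le
      (one_le_mul_of_one_le_of_one_le hK hFX) hξF) hξA
  have u2 : b ≤ κ ^ 3 * H * q := by
    have h1 : v ≤ κ ^ 3 * H * u := by
      have h3 : κ ≤ κ ^ 3 * 1 := by rw [mul_one]; exact le_self_pow₀ hκ1 (by norm_num)
      rw [hv]
      refine mul_le_mul_of_nonneg_right (h3.trans ?_) hu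
      exact mul_le_mul_of_nonneg_left hH1 (by positivity)
    have h2 : ξF * (ξA * EA) ≤ ξF * (ξA * (κ ^ 3 * (K * FX) *
        (c₁ * ε + (c₂ + 2 * n + 3 / 2 * d + 2) * u))) := by gcongr
    calc b ≤ ξF * (ξA * (κ ^ 3 * (K * FX) * (c₁ * ε + (c₂ + 2 * n + 3 / 2 * d + 2) * u))) +
          κ ^ 3 * H * u := by rw [hb]; exact add_le_add h2 h1
      _ = _ := by rw [hH, hq]; ring
  have u3 : s₂ ≤ κ ^ 4 * (FY * H) * (c₁ * q + c₂ * u) := by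
    have h1 : c₁ * eY ≤ κ ^ 4 * H * (c₁ * q) := by
      calc c₁ * eY ≤ c₁ * (κ * (κ ^ 3 * H * q)) := by rw [heY]; gcongr
        _ = _ := by ring
    have h2 : c₂ * v ≤ κ ^ 4 * H * (c₂ * u) := by
      have h3 : κ ≤ κ ^ 4 * 1 := by
        rw [mul_one]; exact le_self_pow₀ hκ1 (by norm_num)
      calc c₂ * v = κ * (c₂ * u) := by rw [hv]; ring
        _ ≤ _ := mul_le_mul_of_nonneg_right
          (h3.trans (mul_le_mul_of_nonneg_left hH1 (by positivity))) (by positivity)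
    calc s₂ ≤ FY * (κ ^ 4 * H * (c₁ * q) + κ ^ 4 * H * (c₂ * u)) := by
          rw [hs₂]; gcongr
      _ = _ := by ring
  have hκ5 : κ ≤ κ ^ 5 := le_self_pow₀ hκ1 (by norm_num)
  have hFH : 1 ≤ FY * H := one_le_mul_of_one_le_of_one_le hFY hH1
  have u4 : E₂ ≤ κ ^ 5 * (FY * H) * (c₁ * q + c₂ * u + (d + Θ.D + 2) * u) := by
    have h2 : (d + Θ.D + 2) * v ≤ κ ^ 5 * (FY * H) * ((d + Θ.D + 2) * u) := by
      calc (d + Θ.D + 2) * v = κ * 1 * ((d + Θ.D + 2) * u) := by rw [hv]; ring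
        _ ≤ _ := by gcongr
    calc E₂ ≤ κ * (κ ^ 4 * (FY * H) * (c₁ * q + c₂ * u)) +
          κ ^ 5 * (FY * H) * ((d + Θ.D + 2) * u) := by
          rw [hE₂, ha₂]; gcongr
      _ = _ := by ring
  have u5 : bZ ≤ κ ^ 5 * T := by
    have h2 : v ≤ κ ^ 5 * (P * (FY * H)) * u := by
      calc v = κ * (1 * 1) * u := by rw [hv]; ring
        _ ≤ _ := by gcongr
    have h3 : ξG t * (ξM t * E₂) ≤ P * E₂ := by
      rw [← mul_assoc]; gcongr
    calc bZ ≤ P * (κ ^ 5 * (FY * H) * (c₁ * q + c₂ * u + (d + Θ.D + 2) * u)) +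
          κ ^ 5 * (P * (FY * H)) * u := by
          rw [hbZ]; exact add_le_add (h3.trans (by gcongr)) h2
      _ = _ := by rw [hT, hH, hq]; ring
  have hsZ : bZ ≤ (κ - 1) / 8 := u5.trans hs
  have hR : Rounds u v := ⟨hv0, fun x z hz => by
    rw [hv]; exact hz.rel hκ (by linarith)⟩
  have hXr : ∀ i t, Rel e (X i t) (Xh i t) := fun i t => by
    rw [he]; exact rel_of_abs_sub_le_mul (hX i t) hε hκ (by linarith)
  have hYc : ∀ i t, Rel eY (attnBlock ν Θ X i t) (Y i t) := fun i t => by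
    have h1 := FlAttnBlock.cl hR he0 (a := a₁) (l3.trans l4) hd0 h.hW hY hXr
      (fun t z hz i => by
        rw [ha₁, hs₁]
        exact h.relX t κ u v e hR hκ1 hκ he0 (by rw [← hs₁]; linarith) _ z (fun i => hXr i t) hz i)
      h.norm_le hκ1 hκ (by linarith) hξA hξF h.leA h.leF i t
    rw [← hEA, ← hb] at h1
    rw [heY]
    exact h1.toRel hb0 hκ (by linarith)
  have hfin := FlTlpBlock.cl hR heY0 (a := a₂) (l8.trans l9) (hZ t) (fun i => hYc i t)
    (fun z hz i => by
      rw [ha₂, hs₂]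
      exact h.relY t κ u v eY hR hκ1 hκ heY0 (by rw [← hs₂]; linarith) _ z (fun i => hYc i t) hz i)
    (fun k => lt_of_le_of_lt (mul_le_mul_of_nonneg_right
      (sub_le_sub_right (Real.exp_le_exp.2 (by linarith)) 1) (absMat_mulVec_absVec_add_nonneg _ _ _ k)) (hsign t k))
    hM hG (h.leM t) (h.leG t) i
  rw [← hE₂, ← hbZ] at hfin
  refine hfin.2.trans (mul_le_mul_of_nonneg_right ?_ (abs_nonneg _))
  calc _ ≤ κ * bZ := exp_sub_one_le_mul hbZ0 hκ (by linarith)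
    _ ≤ κ * (κ ^ 5 * T) := by gcongr
    _ = _ := by ring

/-- With `w = u + ε` and `κ = 1 + M w`, one has `κ^6 T = T + O(w T)`, and `T = O(w)`. -/
theorem exists_abs_sub_le (h : BlockData ν flν Θ X c₁ c₂ FX FY ξA ξF P ξM ξG) :
    ∃ C r₀ : ℝ, 0 ≤ C ∧ 0 < r₀ ∧ ∀ u ε : ℝ, 0 < u → u ≤ r₀ → 0 ≤ ε → ε ≤ r₀ →
      ∀ Xh Z : Matrix (Fin d) (Fin n) ℝ, (∀ i t, |Xh i t - X i t| ≤ ε * |X i t|) →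
        FlBlock flν u Θ Xh Z → ∀ i t, |Z i t - block ν Θ X i t| ≤
          (P * FY * (attnFactor Θ * FX * ξF * ξA) *
            ((c₁ * (c₂ + 2 * n + 3 / 2 * d + 3) + c₂ + d + Θ.D + 3) * u + c₁ ^ 2 * ε) +
              C * (u ^ 2 + ε ^ 2)) * |block ν Θ X i t| := by
  have hd0 : 0 < d := by have := h.hd; omega
  have hK := one_le_attnFactor hd0 Θ h.hW
  have hc₁ := h.hc₁
  have hc₂ := h.hc₂
  have hFX := h.hFX
  have hFY := h.hFY
  have hξA := h.hξA
  have hξF := h.hξF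
  have hP := h.hP
  obtain ⟨G, hG⟩ : ∃ G, G = P * FY * (attnFactor Θ * FX * ξF * ξA) := ⟨_, rfl⟩
  obtain ⟨p, hp⟩ : ∃ p, p = c₁ * (c₂ + 2 * n + 3 / 2 * d + 3) + c₂ + d + Θ.D + 3 := ⟨_, rfl⟩
  have hG0 : 0 < G := by rw [hG]; positivity
  have hp0 : 0 < p := by rw [hp]; positivity
  obtain ⟨N, hN⟩ : ∃ N, N = G * (p + c₁ ^ 2) := ⟨_, rfl⟩
  have hN0 : 0 < N := by rw [hN]; positivity
  -- There are finitely many non-zero first-layer entries, so one `δ` protects all their signs. The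
  -- 64 is `2 · 32`, from `κ ≤ 2` and `κ^5 ≤ 32`.
  obtain ⟨δ, hδ0, hδ⟩ : ∃ δ > (0 : ℝ), ∀ q : Fin n × Fin Θ.D, 64 * N * δ *
      ((absMat Θ.A₁ *ᵥ absVec (ν ((attnBlock ν Θ X).col q.1))) q.2 + |Θ.b₁ q.2|) <
        |layer₁ Θ (ν ((attnBlock ν Θ X).col q.1)) q.2| := by
    have : ∀ᶠ δ in nhdsWithin (0 : ℝ) (Set.Ioi 0), ∀ q : Fin n × Fin Θ.D, 64 * N * δ *
        ((absMat Θ.A₁ *ᵥ absVec (ν ((attnBlock ν Θ X).col q.1))) q.2 + |Θ.b₁ q.2|) <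
          |layer₁ Θ (ν ((attnBlock ν Θ X).col q.1)) q.2| := by
      refine Filter.eventually_all.2 fun q => nhdsWithin_le_nhds ?_
      have hcont : Continuous fun δ : ℝ => 64 * N * δ *
        ((absMat Θ.A₁ *ᵥ absVec (ν ((attnBlock ν Θ X).col q.1))) q.2 + |Θ.b₁ q.2|) := by
        fun_prop
      refine hcont.continuousAt.eventually_lt continuousAt_const ?_
      simpa using h.layer₁_ne q.1 q.2
    obtain ⟨δ, h1, h2⟩ := (this.and self_mem_nhdsWithin).exists
    exact ⟨δ, h2, h1⟩
  -- `256 = 8 · 32` makes `κ^5 T ≤ 32 N w` equal to at most `(κ - 1)/8`.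
  obtain ⟨M, hM⟩ : ∃ M, M = 256 * N := ⟨_, rfl⟩
  have hM0 : 0 < M := by rw [hM]; positivity
  -- The radius ensures `M w ≤ 1` and `w ≤ δ`. The constant is `2 · 63 M N`: 63 is `2^6 - 1`, from
  -- expanding `κ^6`, and the 2 is from `(u + ε)² ≤ 2 (u² + ε²)`.
  refine ⟨126 * M * N, min (1 / (2 * M)) (δ / 2), by positivity, by positivity,
    fun u ε hu hur hε hεr Xh Z hX hZ i t => ?_⟩
  obtain ⟨w, hw⟩ : ∃ w, w = u + ε := ⟨_, rfl⟩
  have hw0 : 0 ≤ w := by rw [hw]; positivity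
  have hwM : M * w ≤ 1 := by
    have h1 := hur.trans (min_le_left _ _)
    have h2 := hεr.trans (min_le_left _ _)
    have h3 : w ≤ 1 / M := by
      calc w ≤ 1 / (2 * M) + 1 / (2 * M) := by rw [hw]; linarith
        _ = _ := by field_simp; norm_num
    rw [le_div_iff₀ hM0] at h3
    linarith
  have hwδ : w ≤ δ := by
    have h1 := hur.trans (min_le_right _ _)
    have h2 := hεr.trans (min_le_right _ _)
    linarith
  obtain ⟨T, hT⟩ : ∃ T, T = G * (p * u + c₁ ^ 2 * ε) := ⟨_, rfl⟩
  have hT0 : 0 ≤ T := by rw [hT]; positivity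
  have hTw : T ≤ N * w := by
    have h1 : p * u + c₁ ^ 2 * ε ≤ (p + c₁ ^ 2) * w := by
      have h2 : 0 ≤ p * ε + c₁ ^ 2 * u := by positivity
      rw [hw]; linarith
    rw [hT, hN, mul_assoc]
    exact mul_le_mul_of_nonneg_left h1 hG0.le
  obtain ⟨κ, hκ⟩ : ∃ κ, κ = 1 + M * w := ⟨_, rfl⟩
  have hMw : 0 ≤ M * w := by positivity
  have hκ1 : 1 ≤ κ := by linarith
  have hκ2 : κ ≤ 2 := by linarith
  have hκ5 : κ ^ 5 ≤ 32 := by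
    calc κ ^ 5 ≤ 2 ^ 5 := by gcongr
      _ = 32 := by norm_num
  have hT5 : κ ^ 5 * T ≤ 32 * (N * w) := mul_le_mul hκ5 hTw hT0 (by norm_num)
  have hs : κ ^ 5 * T ≤ (κ - 1) / 8 := by
    refine hT5.trans ?_
    rw [hκ, hM]
    linarith
  have hB : ∀ t k, 0 ≤ (absMat Θ.A₁ *ᵥ absVec (ν ((attnBlock ν Θ X).col t))) k + |Θ.b₁ k| :=
    fun t k => absMat_mulVec_absVec_add_nonneg _ _ _ k
  have hsign : ∀ t k, (Real.exp (κ ^ 5 * T) - 1) *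
      ((absMat Θ.A₁ *ᵥ absVec (ν ((attnBlock ν Θ X).col t))) k + |Θ.b₁ k|) <
        |layer₁ Θ (ν ((attnBlock ν Θ X).col t)) k| := fun t k => by
    refine lt_of_le_of_lt (mul_le_mul_of_nonneg_right ?_ (hB t k)) (hδ (t, k))
    have h1 := exp_sub_one_le_mul (κ := κ) (a := κ ^ 5 * T) (by positivity) hκ2 (by linarith)
    calc _ ≤ κ * (κ ^ 5 * T) := h1
      _ ≤ 2 * (32 * (N * δ)) :=
        mul_le_mul hκ2 (hT5.trans (by gcongr)) (by positivity) (by norm_num)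
      _ = _ := by ring
  have hmain := h.abs_sub_le hκ1 hκ2 hu.le hε (by rw [← hG, ← hp]; exact hT) hs hsign hX hZ i t
  refine hmain.trans (mul_le_mul_of_nonneg_right ?_ (abs_nonneg _))
  rw [← hG, ← hp, ← hT]
  have h6 : κ ^ 6 ≤ 1 + 63 * (M * w) := by
    have hx := hwM
    obtain ⟨x, hx'⟩ : ∃ x, x = M * w := ⟨_, rfl⟩
    rw [← hx'] at hx hMw hκ ⊢
    have hk : ∀ k : ℕ, x ^ (k + 1) ≤ x := fun k => pow_le_of_le_one hMw hx (by simp)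
    have := hk 1
    have := hk 2
    have := hk 3
    have := hk 4
    have := hk 5
    rw [hκ]
    calc (1 + x) ^ 6 = 1 + 6 * x + 15 * x ^ (1 + 1) + 20 * x ^ (2 + 1) + 15 * x ^ (3 + 1) +
          6 * x ^ (4 + 1) + x ^ (5 + 1) := by ring
      _ ≤ _ := by linarith
  have h7 : w ^ 2 ≤ 2 * (u ^ 2 + ε ^ 2) := by
    rw [hw]; nlinarith [sq_nonneg (u - ε)]
  calc κ ^ 6 * T ≤ (1 + 63 * (M * w)) * T := by gcongr
    _ = T + 63 * M * w * T := by ring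
    _ ≤ T + 63 * M * w * (N * w) := by gcongr
    _ = T + 63 * M * N * w ^ 2 := by ring
    _ ≤ T + 63 * M * N * (2 * (u ^ 2 + ε ^ 2)) := by gcongr
    _ = _ := by ring

end BlockData

/-! ### Condition numbers in `[0, ∞]` -/

theorem abs_le_of_ratio_le {a b : ℝ} {x : ℝ≥0∞} (hx : x ≠ ⊤) (h : ratio a b ≤ x) :
    |a| ≤ x.toReal * |b| := by
  rw [ratio, ENNReal.div_le_iff_le_mul (Or.inr hx) (Or.inl ENNReal.ofReal_ne_top)] at h
  have h1 := ENNReal.toReal_mono (ENNReal.mul_ne_top hx ENNReal.ofReal_ne_top) h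
  rwa [ENNReal.toReal_mul, ENNReal.toReal_ofReal (abs_nonneg _),
    ENNReal.toReal_ofReal (abs_nonneg _)] at h1

theorem ratio_le_of_abs_le {a b x : ℝ} (hx : 0 ≤ x) (h : |a| ≤ x * |b|) :
    ratio a b ≤ ENNReal.ofReal x := by
  refine ENNReal.div_le_of_le_mul ?_
  rw [← ENNReal.ofReal_mul hx]
  exact ENNReal.ofReal_le_ofReal h

theorem one_le_ratio {a b : ℝ} (ha : a ≠ 0) (h : |b| ≤ |a|) : 1 ≤ ratio a b := by
  rw [ratio, ENNReal.le_div_iff_mul_le (Or.inr (by simpa using ha)) (Or.inl ENNReal.ofReal_ne_top),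
    one_mul]
  exact ENNReal.ofReal_le_ofReal h

theorem abs_mulVec_le {m n : ℕ} (A : Matrix (Fin m) (Fin n) ℝ) {x B : Fin n → ℝ}
    (h : ∀ j, |x j| ≤ B j) (i : Fin m) : |(A *ᵥ x) i| ≤ (absMat A *ᵥ B) i := by
  change |∑ j, A i j * x j| ≤ ∑ j, |A i j| * B j
  refine (Finset.abs_sum_le_sum_abs _ _).trans (Finset.sum_le_sum fun j _ => ?_)
  rw [abs_mul]
  exact mul_le_mul_of_nonneg_left (h j) (abs_nonneg _)

theorem abs_attention_le {d n : ℕ} (Θ : Config d) (X : Matrix (Fin d) (Fin n) ℝ) (i : Fin d)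
    (t : Fin n) : |attention Θ X i t| ≤
      (absMat Θ.Wv *ᵥ (absMat (firstCols X t) *ᵥ probs Θ X t)) i :=
  abs_mulVec_le _ (fun _ => abs_mulVec_le _ (fun _ => (abs_of_nonneg (softmax_nonneg _ _)).le) _) _

theorem abs_tlp_le {d : ℕ} (Θ : Config d) (x : Fin d → ℝ) (i : Fin d) :
    |tlp Θ x i| ≤ (∑ k with 0 < layer₁ Θ x k,
      |Θ.A₂ i k| * ((absMat Θ.A₁ *ᵥ absVec x) k + |Θ.b₁ k|)) + |Θ.b₂ i| := by
  have h1 : ∀ k, |layer₁ Θ x k| ≤ (absMat Θ.A₁ *ᵥ absVec x) k + |Θ.b₁ k| := fun k =>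
    (abs_add_le _ _).trans (add_le_add_left (abs_mulVec_le _ (fun _ => le_rfl) _) _)
  refine (abs_add_le _ _).trans (add_le_add_left ?_ _)
  change |∑ k, Θ.A₂ i k * relu (layer₁ Θ x) k| ≤ _
  refine (Finset.abs_sum_le_sum_abs _ _).trans ?_
  rw [Finset.sum_filter]
  refine Finset.sum_le_sum fun k _ => ?_
  rw [abs_mul]
  split_ifs with hk
  · refine mul_le_mul_of_nonneg_left ?_ (abs_nonneg _)
    rw [relu, max_eq_right hk.le]
    exact h1 k
  · rw [relu, max_eq_left (not_lt.1 hk)]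
    simp

/-- Genericity keeps the numerator positive, which rules out the value `0 / 0 = 0`. Lower bounds by
one prevent a product `0 · ∞` in the final estimate. -/
theorem one_le_xiAttn {d n : ℕ} (hd : 0 < d) (t : Fin n) {Θ : Config d}
    {X : Matrix (Fin d) (Fin n) ℝ} (h : Generic (attention Θ X)) : 1 ≤ xiAttn Θ X := by
  refine le_trans ?_ (le_iSup₂_of_le (⟨0, hd⟩ : Fin d) t le_rfl)
  have h1 := abs_attention_le Θ X ⟨0, hd⟩ t
  exact one_le_ratio ((abs_pos.2 (h _ _)).trans_le h1).ne' (h1.trans (le_abs_self _))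

theorem one_le_xiAttnBlock {d n : ℕ} (hd : 0 < d) (t : Fin n) {Θ : Config d}
    {ν : (Fin d → ℝ) → (Fin d → ℝ)} {X : Matrix (Fin d) (Fin n) ℝ}
    (h : Generic (attention Θ (colMap ν X))) : 1 ≤ xiAttnBlock ν Θ X := by
  refine le_trans ?_ (le_iSup₂_of_le (⟨0, hd⟩ : Fin d) t le_rfl)
  have h1 : 0 < |X ⟨0, hd⟩ t| + |attention Θ (colMap ν X) ⟨0, hd⟩ t| :=
    add_pos_of_nonneg_of_pos (abs_nonneg _) (abs_pos.2 (h _ _))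
  exact one_le_ratio h1.ne' ((abs_add_le _ _).trans (le_abs_self _))

theorem one_le_xiTlp {d : ℕ} (hd : 0 < d) {Θ : Config d} {x : Fin d → ℝ}
    (h : GenericVec (tlp Θ x)) : 1 ≤ xiTlp Θ x := by
  refine le_trans ?_ (le_iSup_of_le (⟨0, hd⟩ : Fin d) le_rfl)
  have h1 := abs_tlp_le Θ x ⟨0, hd⟩
  exact one_le_ratio ((abs_pos.2 (h _)).trans_le h1).ne' (h1.trans (le_abs_self _))

theorem one_le_xiTlpBlock {d : ℕ} (hd : 0 < d) {Θ : Config d} {ν : (Fin d → ℝ) → (Fin d → ℝ)}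
    {x : Fin d → ℝ} (h : GenericVec (tlp Θ (ν x))) : 1 ≤ xiTlpBlock ν Θ x := by
  refine le_trans ?_ (le_iSup_of_le (⟨0, hd⟩ : Fin d) le_rfl)
  have h1 : 0 < |x ⟨0, hd⟩| + |tlp Θ (ν x) ⟨0, hd⟩| :=
    add_pos_of_nonneg_of_pos (abs_nonneg _) (abs_pos.2 (h _))
  exact one_le_ratio h1.ne' ((abs_add_le _ _).trans (le_abs_self _))

theorem exists_rhoC_le {d n : ℕ} (hd : 2 ≤ d) {Θ : Config d} (hW : IsUnit (Θ.Wkᵀ * Θ.Wq))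
    {X : Matrix (Fin d) (Fin n) ℝ} {ν : (Fin d → ℝ) → (Fin d → ℝ)}
    {flν : ℝ → (Fin d → ℝ) → (Fin d → ℝ) → Prop} {c₁ c₂ : ℝ} {FX FY : ℝ≥0∞}
    (hc₁ : 1 ≤ c₁) (hc₂ : 0 ≤ c₂) (hFX : 1 ≤ FX) (hFY : 1 ≤ FY)
    (hn : ∀ x, ‖WithLp.toLp 2 (ν x)‖ ≤ √(d : ℝ))
    (relX : FX ≠ ⊤ → ∀ t, NormRel ν flν c₁ c₂ FX.toReal (X.col t))
    (relY : FY ≠ ⊤ → ∀ t, NormRel ν flν c₁ c₂ FY.toReal ((attnBlock ν Θ X).col t))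
    (hA : Generic (attention Θ (colMap ν X)))
    (hM : ∀ t, GenericVec (tlp Θ (ν ((attnBlock ν Θ X).col t))))
    (hL : ∀ t k, layer₁ Θ (ν ((attnBlock ν Θ X).col t)) k ≠ 0) :
    ∃ C r₀ : ℝ, 0 ≤ C ∧ 0 < r₀ ∧ ∀ u : ℝ, 0 < u → u ≤ r₀ →
      ∀ Xh Z : Matrix (Fin d) (Fin n) ℝ, rhoC Xh X ≤ ENNReal.ofReal r₀ →
        FlBlock flν u Θ Xh Z → rhoC Z (block ν Θ X) ≤
          (⨆ t : Fin n, xiTlpBlock ν Θ ((attnBlock ν Θ X).col t) *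
              xiTlp Θ (ν ((attnBlock ν Θ X).col t))) *
            xiAttnBlock ν Θ X * xiAttn Θ (colMap ν X) * ENNReal.ofReal (attnFactor Θ) * FX * FY *
            (ENNReal.ofReal ((c₁ * (c₂ + 2 * n + 3 / 2 * d + 3) + c₂ + d + Θ.D + 3) * u) +
              ENNReal.ofReal (c₁ ^ 2) * rhoC Xh X) +
          ENNReal.ofReal C * (ENNReal.ofReal (u ^ 2) + rhoC Xh X ^ 2) := by
  have hd0 : 0 < d := by omega
  rcases isEmpty_or_nonempty (Fin n) with hemp | ⟨⟨t₀⟩⟩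
  · exact ⟨0, 1, le_rfl, one_pos, fun u _ _ Xh Z _ _ => by simp [rhoC]⟩
  have hK := one_le_attnFactor hd0 Θ hW
  obtain ⟨ξM, hξM⟩ : ∃ ξ : Fin n → ℝ≥0∞, ξ = fun t => xiTlp Θ (ν ((attnBlock ν Θ X).col t)) :=
    ⟨_, rfl⟩
  obtain ⟨ξG, hξG⟩ : ∃ ξ : Fin n → ℝ≥0∞, ξ = fun t => xiTlpBlock ν Θ ((attnBlock ν Θ X).col t) :=
    ⟨_, rfl⟩
  obtain ⟨P, hP⟩ : ∃ P : ℝ≥0∞, P = ⨆ t : Fin n, ξG t * ξM t := ⟨_, rfl⟩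
  obtain ⟨ξF, hξF⟩ : ∃ ξ, ξ = xiAttnBlock ν Θ X := ⟨_, rfl⟩
  obtain ⟨ξA, hξA⟩ : ∃ ξ, ξ = xiAttn Θ (colMap ν X) := ⟨_, rfl⟩
  obtain ⟨K, hKdef⟩ : ∃ K, K = ENNReal.ofReal (attnFactor Θ) := ⟨_, rfl⟩
  have oneM : ∀ t, 1 ≤ ξM t := fun t => by rw [hξM]; exact one_le_xiTlp hd0 (hM t)
  have oneG : ∀ t, 1 ≤ ξG t := fun t => by rw [hξG]; exact one_le_xiTlpBlock hd0 (hM t)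
  have leP : ∀ t, ξG t * ξM t ≤ P := fun t => by
    rw [hP]; exact le_iSup (fun t => ξG t * ξM t) t
  have oneP : 1 ≤ P := le_trans (one_le_mul (oneG t₀) (oneM t₀)) (leP t₀)
  have oneF : 1 ≤ ξF := by rw [hξF]; exact one_le_xiAttnBlock hd0 t₀ hA
  have oneA : 1 ≤ ξA := by rw [hξA]; exact one_le_xiAttn hd0 t₀ hA
  have oneK : 1 ≤ K := by rw [hKdef]; simpa using hK
  have hp : 0 < c₁ * (c₂ + 2 * n + 3 / 2 * d + 3) + c₂ + d + Θ.D + 3 := by positivity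
  have hgoal : (⨆ t : Fin n, xiTlpBlock ν Θ ((attnBlock ν Θ X).col t) *
      xiTlp Θ (ν ((attnBlock ν Θ X).col t))) = P := by rw [hP, hξG, hξM]
  rw [hgoal, ← hξF, ← hξA, ← hKdef]
  -- If the product is infinite, the right-hand side is infinite because the coefficient of `u` is
  -- positive. Otherwise each factor is finite, since all others are at least one, and the
  -- real-valued estimate applies.
  by_cases htop : P * ξF * ξA * K * FX * FY = ⊤
  · refine ⟨0, 1, le_rfl, one_pos, fun u hu _ Xh Z _ _ => ?_⟩
    rw [htop, ENNReal.top_mul]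
    · simp
    · have : 0 < ENNReal.ofReal
          ((c₁ * (c₂ + 2 * n + 3 / 2 * d + 3) + c₂ + d + Θ.D + 3) * u) :=
        ENNReal.ofReal_pos.2 (mul_pos hp hu)
      exact (this.trans_le le_self_add).ne'
  have h5 := le_mul_of_one_le_right' (a := P * ξF * ξA * K * FX) hFY
  have h4 := (le_mul_of_one_le_right' (a := P * ξF * ξA * K) hFX).trans h5
  have h3 := (le_mul_of_one_le_right' (a := P * ξF * ξA) oneK).trans h4
  have h2 := (le_mul_of_one_le_right' (a := P * ξF) oneA).trans h3
  have h1 := (le_mul_of_one_le_right' (a := P) oneF).trans h2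
  have tP : P ≠ ⊤ := ne_top_of_le_ne_top htop h1
  have tF : ξF ≠ ⊤ := ne_top_of_le_ne_top htop ((le_mul_of_one_le_left' oneP).trans h2)
  have tA : ξA ≠ ⊤ := ne_top_of_le_ne_top htop
    ((le_mul_of_one_le_left' (one_le_mul oneP oneF)).trans h3)
  have tX : FX ≠ ⊤ := ne_top_of_le_ne_top htop
    ((le_mul_of_one_le_left' (one_le_mul (one_le_mul (one_le_mul oneP oneF) oneA) oneK)).trans h5)
  have tY : FY ≠ ⊤ := ne_top_of_le_ne_top htop (le_mul_of_one_le_left'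
    (one_le_mul (one_le_mul (one_le_mul (one_le_mul oneP oneF) oneA) oneK) hFX))
  have tM : ∀ t, ξM t ≠ ⊤ := fun t =>
    ne_top_of_le_ne_top tP ((le_mul_of_one_le_left' (oneG t)).trans (leP t))
  have tG : ∀ t, ξG t ≠ ⊤ := fun t =>
    ne_top_of_le_ne_top tP ((le_mul_of_one_le_right' (oneM t)).trans (leP t))
  have one_toReal : ∀ {x : ℝ≥0∞}, x ≠ ⊤ → 1 ≤ x → 1 ≤ x.toReal := fun hx h => by
    simpa using ENNReal.toReal_mono hx h
  have data : BlockData ν flν Θ X c₁ c₂ FX.toReal FY.toReal ξA.toReal ξF.toReal P.toReal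
      (fun t => (ξM t).toReal) (fun t => (ξG t).toReal) :=
    { hd := hd
      hW := hW
      hc₁ := hc₁
      hc₂ := hc₂
      hFX := one_toReal tX hFX
      hFY := one_toReal tY hFY
      hξA := one_toReal tA oneA
      hξF := one_toReal tF oneF
      hP := one_toReal tP oneP
      hξM := fun t => one_toReal (tM t) (oneM t)
      hξG := fun t => one_toReal (tG t) (oneG t)
      hMG := fun t => by
        rw [← ENNReal.toReal_mul]
        exact ENNReal.toReal_mono tP (leP t)
      norm_le := hn
      relX := relX tX
      relY := relY tY
      leA := fun i t => (le_abs_self _).trans (abs_le_of_ratio_le tA (by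
        rw [hξA]
        exact le_iSup₂ (f := fun i t => ratio ((absMat Θ.Wv *ᵥ (absMat (firstCols (colMap ν X) t) *ᵥ
          probs Θ (colMap ν X) t)) i) (attention Θ (colMap ν X) i t)) i t))
      leF := fun i t => (le_abs_self _).trans (abs_le_of_ratio_le tF (by
        rw [hξF]
        exact le_iSup₂ (f := fun i t => ratio (|X i t| + |attention Θ (colMap ν X) i t|)
          (attnBlock ν Θ X i t)) i t))
      leM := fun t i => (le_abs_self _).trans (abs_le_of_ratio_le (tM t) (by
        rw [hξM]
        exact le_iSup (fun i => ratio ((∑ k with 0 < layer₁ Θ (ν ((attnBlock ν Θ X).col t)) k,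
          |Θ.A₂ i k| * ((absMat Θ.A₁ *ᵥ absVec (ν ((attnBlock ν Θ X).col t))) k + |Θ.b₁ k|)) +
            |Θ.b₂ i|) (tlp Θ (ν ((attnBlock ν Θ X).col t)) i)) i))
      leG := fun t i => (le_abs_self _).trans (abs_le_of_ratio_le (tG t) (by
        rw [hξG]
        exact le_iSup (fun i => ratio (|(attnBlock ν Θ X).col t i| +
          |tlp Θ (ν ((attnBlock ν Θ X).col t)) i|)
            (tlpBlock ν Θ ((attnBlock ν Θ X).col t) i)) i))
      layer₁_ne := hL }
  obtain ⟨C, r₀, hC, hr₀, hmain⟩ := data.exists_abs_sub_le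
  refine ⟨C, r₀, hC, hr₀, fun u hu hur Xh Z hρ hZ => ?_⟩
  have tρ : rhoC Xh X ≠ ⊤ := ne_top_of_le_ne_top ENNReal.ofReal_ne_top hρ
  have hε : (rhoC Xh X).toReal ≤ r₀ := ENNReal.toReal_le_of_le_ofReal hr₀.le hρ
  have hb := hmain u (rhoC Xh X).toReal hu hur ENNReal.toReal_nonneg hε Xh Z
    (fun i t => abs_le_of_ratio_le tρ
      (le_iSup₂ (f := fun i t => ratio (Xh i t - X i t) (X i t)) i t)) hZ
  refine iSup₂_le fun i t => ?_
  refine (ratio_le_of_abs_le (by positivity) (hb i t)).trans (le_of_eq ?_)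
  obtain ⟨p, hpdef⟩ : ∃ p, p = c₁ * (c₂ + 2 * n + 3 / 2 * d + 3) + c₂ + d + Θ.D + 3 := ⟨_, rfl⟩
  rw [← hpdef] at hp ⊢
  have e1 : P * ξF * ξA * K * FX * FY = ENNReal.ofReal (P.toReal * FY.toReal *
      (attnFactor Θ * FX.toReal * ξF.toReal * ξA.toReal)) := by
    have hK0 : 0 ≤ attnFactor Θ := by linarith
    have : P.toReal * FY.toReal * (attnFactor Θ * FX.toReal * ξF.toReal * ξA.toReal) =
        (P * ξF * ξA * K * FX * FY).toReal := by
      simp only [ENNReal.toReal_mul, hKdef, ENNReal.toReal_ofReal hK0]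
      ring
    rw [this, ENNReal.ofReal_toReal htop]
  obtain ⟨ε, hε0, hεe⟩ : ∃ ε : ℝ, 0 ≤ ε ∧ rhoC Xh X = ENNReal.ofReal ε :=
    ⟨_, ENNReal.toReal_nonneg, (ENNReal.ofReal_toReal tρ).symm⟩
  rw [e1, hεe, ENNReal.toReal_ofReal hε0, ← ENNReal.ofReal_pow hε0,
    ← ENNReal.ofReal_mul (by positivity),
    ← ENNReal.ofReal_add (by positivity) (by positivity),
    ← ENNReal.ofReal_add (by positivity) (by positivity),
    ← ENNReal.ofReal_mul (by positivity), ← ENNReal.ofReal_mul hC,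
    ← ENNReal.ofReal_add (by positivity) (by positivity)]

/-! ### Consequences of the stability assumptions that do not involve `u` -/

theorem gam_nonneg {d : ℕ} {u : ℝ} (hd : 0 < d) (hu : 0 < u) (h : u ≤ 1 / (2 * d)) :
    0 ≤ gam u d := by
  have hd' : (0 : ℝ) < d := by exact_mod_cast hd
  rw [le_div_iff₀ (by positivity)] at h
  exact div_nonneg (by positivity) (by linarith)

theorem SignStable.layer₁_ne {d : ℕ} {Θ : Config d} {α u : ℝ} {x : Fin d → ℝ} (hα : 0 ≤ α)
    (hu : 0 ≤ u) (hg : 0 ≤ gam u d) (h : SignStable Θ α u x) (k : Fin Θ.D) :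
    layer₁ Θ x k ≠ 0 :=
  abs_pos.1 (lt_of_le_of_lt
    (mul_nonneg (by positivity) (absMat_mulVec_absVec_add_nonneg _ _ _ _)) (h k))

theorem minAbs_le {d : ℕ} (x : Fin d → ℝ) (i : Fin d) : minAbs x ≤ |x i| :=
  ciInf_le (Finite.bddBelow_range fun i => |x i|) i

theorem minAbs_pos {d : ℕ} (hd : 0 < d) {x : Fin d → ℝ} (h : GenericVec x) : 0 < minAbs x := by
  have : Nonempty (Fin d) := ⟨⟨0, hd⟩⟩
  obtain ⟨i, hi⟩ := exists_eq_ciInf_of_finite (f := fun i => |x i|)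
  rw [minAbs, ← hi]
  exact abs_pos.2 (h i)

theorem CentrStable.generic {d : ℕ} {α u : ℝ} {x : Fin d → ℝ} (hα : 0 ≤ α)
    (hu : 0 ≤ u) (hg : 0 ≤ gam u d) (h : CentrStable α u x) : GenericVec (centr x) := fun i =>
  abs_pos.1 (lt_of_lt_of_le (lt_of_le_of_lt (by positivity) h) (minAbs_le _ i))

theorem normRel_normFactor {d n : ℕ} (hd : 2 ≤ d) {X : Matrix (Fin d) (Fin n) ℝ}
    (hc : ∀ t, GenericVec (centr (X.col t))) (hX : normFactor X ≠ ⊤) (t : Fin n) :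
    NormRel layerNorm (fun u => FlLayerNorm u) 4 (9 / 4 * d + 2) (normFactor X).toReal
      (X.col t) := by
  have hd0 : 0 < d := by omega
  obtain ⟨S, hS⟩ : ∃ S, S = ⨆ t : Fin n, ratio ‖X.col t‖ (minAbs (centr (X.col t))) := ⟨_, rfl⟩
  have hF : normFactor X = 1 + S := by rw [hS]; rfl
  have hSt : S ≠ ⊤ := by
    rw [hF] at hX
    exact fun h => hX (by simp [h])
  have hle : ratio ‖X.col t‖ (minAbs (centr (X.col t))) ≤ S := by
    rw [hS]
    exact le_iSup (fun t => ratio ‖X.col t‖ (minAbs (centr (X.col t)))) t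
  have hpos := minAbs_pos hd0 (hc t)
  have hr : 1 ≤ S.toReal := by
    obtain ⟨i, hi⟩ := exists_abs_centr_le_norm hd0 (X.col t)
    have h1 := (minAbs_le _ i).trans hi
    have h2 : 1 ≤ S := le_trans (one_le_ratio (hpos.trans_le h1).ne' (by
      rw [abs_of_pos hpos, abs_norm]
      exact h1)) hle
    simpa using ENNReal.toReal_mono hSt h2
  rw [hF, ENNReal.toReal_add ENNReal.one_ne_top hSt, ENNReal.toReal_one]
  refine normRel_layerNorm hd hr fun i => ?_
  have h1 := abs_le_of_ratio_le hSt hle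
  rw [abs_norm, abs_of_pos hpos] at h1
  exact h1.trans (mul_le_mul_of_nonneg_left (minAbs_le _ i) (by linarith))

theorem norm_layerNorm_le {d : ℕ} (x : Fin d → ℝ) :
    ‖WithLp.toLp 2 (layerNorm x)‖ ≤ √(d : ℝ) := by
  rw [layerNorm_eq_rmsNorm_centr]
  exact norm_rmsNorm_le _

end TransformerRounding

end

/-! ### The two transformer blocks -/

theorem mainTheorem2 {d n : ℕ} (hd : 2 ≤ d) (Θ : Config d) (hW : IsUnit (Θ.Wkᵀ * Θ.Wq))
    (X : Matrix (Fin d) (Fin n) ℝ) :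
    (AssumeAttnR Θ X → ∃ C u₀ r₀ : ℝ, 0 ≤ C ∧ 0 < u₀ ∧ 0 < r₀ ∧
      ∀ u α : ℝ, 0 < u → u ≤ u₀ → 1 ≤ α →
        (∀ t, AssumeTlpR Θ α u ((attnBlock rmsNorm Θ X).col t)) →
        ∀ Xh Z : Matrix (Fin d) (Fin n) ℝ, rhoC Xh X ≤ ENNReal.ofReal r₀ → FlBlockQ u Θ Xh Z →
          rhoC Z (blockQ Θ X) ≤
            (⨆ t : Fin n, xiTlpBlock rmsNorm Θ ((attnBlock rmsNorm Θ X).col t) *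
                xiTlp Θ (rmsNorm ((attnBlock rmsNorm Θ X).col t))) *
              xiAttnBlock rmsNorm Θ X * xiAttn Θ (colMap rmsNorm X) *
              ENNReal.ofReal (attnFactor Θ) *
              (ENNReal.ofReal ((6 * n + 23 * d + Θ.D) * u) + 9 * rhoC Xh X) +
            ENNReal.ofReal C * (ENNReal.ofReal (u ^ 2) + rhoC Xh X ^ 2)) ∧
    (∃ C u₀ r₀ : ℝ, 0 ≤ C ∧ 0 < u₀ ∧ 0 < r₀ ∧
      ∀ u α : ℝ, 0 < u → u ≤ u₀ → 1 ≤ α →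
        AssumeAttnN Θ α u X → (∀ t, AssumeTlpN Θ α u ((attnBlock layerNorm Θ X).col t)) →
        ∀ Xh Z : Matrix (Fin d) (Fin n) ℝ, rhoC Xh X ≤ ENNReal.ofReal r₀ → FlBlockT u Θ Xh Z →
          rhoC Z (blockT Θ X) ≤
            (⨆ t : Fin n, xiTlpBlock layerNorm Θ ((attnBlock layerNorm Θ X).col t) *
                xiTlp Θ (layerNorm ((attnBlock layerNorm Θ X).col t))) *
              xiAttnBlock layerNorm Θ X * xiAttn Θ (colMap layerNorm X) *
              ENNReal.ofReal (attnFactor Θ) *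
              normFactor X * normFactor (attnBlock layerNorm Θ X) *
              (ENNReal.ofReal ((8 * n + 34 * d + Θ.D) * u) + 16 * rhoC Xh X) +
            ENNReal.ofReal C * (ENNReal.ofReal (u ^ 2) + rhoC Xh X ^ 2)) := by
  have hd0 : 0 < d := by omega
  have hd' : (2 : ℝ) ≤ d := by exact_mod_cast hd
  have hthr : (0 : ℝ) < 1 / (2 * d) := by positivity
  constructor
  · intro hX
    -- The constants must be chosen before `u` and `α`, whereas the assumptions depend on both.
    -- Their part free of `u` and `α` is therefore decided first; if it fails, the assumptions fail
    -- for every `u ≤ 1/(2d)`, where `γ_d ≥ 0`, and the claim is vacuous.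
    by_cases hQ : ∀ t, GenericVec (tlp Θ (rmsNorm ((attnBlock rmsNorm Θ X).col t))) ∧
        ∀ k, layer₁ Θ (rmsNorm ((attnBlock rmsNorm Θ X).col t)) k ≠ 0
    · obtain ⟨C, r₀, hC, hr₀, h⟩ := exists_rhoC_le hd hW (X := X) (ν := rmsNorm)
        (flν := fun u => FlRms u) (c₁ := 2) (c₂ := (d : ℝ) / 2 + 4) (FX := 1) (FY := 1)
        (by norm_num) (by positivity) le_rfl le_rfl norm_rmsNorm_le
        (fun _ t => by simpa using normRel_rmsNorm _) (fun _ t => by simpa using normRel_rmsNorm _)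
        hX.2 (fun t => (hQ t).1) (fun t => (hQ t).2)
      refine ⟨C, r₀, r₀, hC, hr₀, hr₀, fun u α hu hur _ _ Xh Z hρ hZ => ?_⟩
      refine (h u hu hur Xh Z hρ hZ).trans ?_
      rw [mul_one, mul_one]
      refine add_le_add_left (mul_le_mul_right (add_le_add (ENNReal.ofReal_le_ofReal
        (mul_le_mul_of_nonneg_right ?_ hu.le)) (mul_le_mul_left ?_ _)) _) _
      -- The coefficient obtained is `4n + 11/2 d + 21 + D`; `d ≥ 2` absorbs the 21.
      · have : (0 : ℝ) ≤ n := by positivity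
        linarith
      · rw [ENNReal.ofReal_le_iff_le_toReal (by simp)]
        norm_num
    · refine ⟨0, 1 / (2 * d), 1, le_rfl, hthr, one_pos, fun u α hu hur hα hY => ?_⟩
      have hg := gam_nonneg hd0 hu hur
      exact absurd (fun t => ⟨(hY t).2.1, (hY t).2.2.layer₁_ne (by linarith) hu.le hg⟩) hQ
  · by_cases hQ : (∀ t, GenericVec (centr (X.col t))) ∧
        Generic (attention Θ (colMap layerNorm X)) ∧
        ∀ t, GenericVec (centr ((attnBlock layerNorm Θ X).col t)) ∧
          GenericVec (tlp Θ (layerNorm ((attnBlock layerNorm Θ X).col t))) ∧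
          ∀ k, layer₁ Θ (layerNorm ((attnBlock layerNorm Θ X).col t)) k ≠ 0
    · obtain ⟨hcX, hA, hY⟩ := hQ
      obtain ⟨C, r₀, hC, hr₀, h⟩ := exists_rhoC_le hd hW (X := X) (ν := layerNorm)
        (flν := fun u => FlLayerNorm u) (c₁ := 4) (c₂ := 9 / 4 * (d : ℝ) + 2)
        (FX := normFactor X) (FY := normFactor (attnBlock layerNorm Θ X))
        (by norm_num) (by positivity) le_self_add le_self_add norm_layerNorm_le
        (normRel_normFactor hd hcX) (normRel_normFactor hd fun t => (hY t).1)
        hA (fun t => (hY t).2.1) (fun t => (hY t).2.2)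
      refine ⟨C, r₀, r₀, hC, hr₀, hr₀, fun u α hu hur _ _ _ Xh Z hρ hZ => ?_⟩
      refine (h u hu hur Xh Z hρ hZ).trans ?_
      refine add_le_add_left (mul_le_mul_right (add_le_add (ENNReal.ofReal_le_ofReal
        (mul_le_mul_of_nonneg_right ?_ hu.le)) (mul_le_mul_left ?_ _)) _) _
      -- The coefficient obtained is `8n + 73/4 d + 25 + D`; `d ≥ 2` absorbs the 25.
      · have : (0 : ℝ) ≤ n := by positivity
        linarith
      · rw [ENNReal.ofReal_le_iff_le_toReal (by simp)]
        norm_num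
    · refine ⟨0, 1 / (2 * d), 1, le_rfl, hthr, one_pos, fun u α hu hur hα hX hY => ?_⟩
      have hg := gam_nonneg hd0 hu hur
      have hα0 : 0 ≤ α := by linarith
      exact absurd ⟨fun t => (hX.1 t).generic hα0 hu.le hg, hX.2, fun t =>
        ⟨(hY t).1.generic hα0 hu.le hg, (hY t).2.1, (hY t).2.2.layer₁_ne hα0 hu.le hg⟩⟩ hQ
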